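/- Let $N\ge 3$. Consider the quantum system with orthonormal basis states $|n,k\rangle$, $1\le n\le N$, $1\le k\le \beta_n$, where $\beta_1=1$ and $\beta_n=2$ for $n\ge 2$ (non-degenerate ground level, two-fold degenerate excited levels; dimension $2N-1$), with $$H_0=\sum_{n=1}^{N}\sum_{k=1}^{\beta_n}E_n|n,k\rangle\langle n,k|,\qquad H_I=\sum_{n=1}^{N-1}\sum_{k=1}^{\beta_n}\sum_{p=1}^{2}d_{nk,n+1\,p}\big(|n,k\rangle\langle n+1,p|+|n+1,p\rangle\langle n,k|\big),$$ where $E_n$ and $d_{nk,n+1\,p}$ are real and the energy gaps $\mu_n=E_{n+1}-E_n$ ($1\le n\le N-1$) are positive. Let $L_0$ be the real Lie algebra generated by $iH_0$ and $iH_I$, and put $y_{nk,ml}=|n,k\rangle\langle m,l|-|m,l\rangle\langle n,k|$. Suppose that $\mu_1\neq\mu_n$ for $n=2,\dots,N-1$ and, with $p=d_{11,21}d_{21,31}+d_{11,22}d_{22,31}$ and $q=d_{11,21}d_{21,32}+d_{11,22}d_{22,32}$, that $$d_{11,21}(p\,d_{22,31}+q\,d_{22,32})\neq d_{11,22}(p\,d_{21,31}+q\,d_{21,32}).$$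 Then $y_{11,21},\,y_{11,22}\in L_0$. If, in addition, $d_{n1,n+1\,1}\,d_{n2,n+1\,2}\neq d_{n1,n+1\,2}\,d_{n2,n+1\,1}$ for $2\le n\le N-1$, then $L_0\supseteq \mathrm{su}(2N-1)$, with $L_0=\mathrm{su}(2N-1)$ if $\operatorname{tr}H_0=0$, and the system $H=H_0+f(t)H_I$ ($\hbar=1$) is completely controllable by the single real control field $f$: every $U\in \mathrm{SU}(2N-1)$ is the time evolution operator over some interval $[0,T]$, $T\ge 0$, for some piecewise constant real-valued $f$, that is, $U$ is a finite product of operators $e^{-it(H_0+cH_I)}$ with $t\ge 0$ and $c\in\mathbb R$. -/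

import Mathlib

-- The commutator bracket on operators.
attribute [local instance 100] LieRing.ofAssociativeRing

namespace DegenerateControl

open Matrix

noncomputable section

/-- Degeneracy of the `n`-th level (levels are numbered from `1`): the ground level is
non-degenerate, all excited levels are two-fold degenerate. -/
def β (n : ℕ) : ℕ := if n = 1 then 1 else 2

/-- The labels `(n, k)`, `1 ≤ n ≤ N`, `1 ≤ k ≤ β n`, of the basis states `|n,k⟩`. -/
def states (N : ℕ) : Finset (ℕ × ℕ) :=
  (Finset.Icc 1 N ×ˢ Finset.Icc 1 2).filter (fun a => a.2 ≤ β a.1)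

/-- Operators on the state space with orthonormal basis `|n,k⟩`, `(n, k) ∈ states N`,
as complex matrices. -/
abbrev Op (N : ℕ) : Type := Matrix (states N) (states N) ℂ

/-- The operator `|a⟩⟨b|`. (It is only used for labels `a, b ∈ states N`.) -/
def ket_bra (N : ℕ) (a b : ℕ × ℕ) : Op N :=
  Matrix.of fun i j => if (i : ℕ × ℕ) = a ∧ (j : ℕ × ℕ) = b then 1 else 0

/-- `H₀ = ∑ₙ ∑ₖ Eₙ |n,k⟩⟨n,k|`. -/
def H₀ (N : ℕ) (E : ℕ → ℝ) : Op N :=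
  ∑ n ∈ Finset.Icc 1 N, ∑ k ∈ Finset.Icc 1 (β n), (E n : ℂ) • ket_bra N (n, k) (n, k)

/-- The dipole interaction
`H_I = ∑ₙ ∑ₖ ∑ₚ d_{nk,n+1p} (|n,k⟩⟨n+1,p| + |n+1,p⟩⟨n,k|)`, where `d_{nk,ml} = d (n, k) (m, l)`. -/
def HI (N : ℕ) (d : ℕ × ℕ → ℕ × ℕ → ℝ) : Op N :=
  ∑ n ∈ Finset.Icc 1 (N - 1), ∑ k ∈ Finset.Icc 1 (β n), ∑ p ∈ Finset.Icc 1 2,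
    (d (n, k) (n + 1, p) : ℂ) •
      (ket_bra N (n, k) (n + 1, p) + ket_bra N (n + 1, p) (n, k))

/-- `y_{a,b} = |a⟩⟨b| - |b⟩⟨a|`. -/
def y (N : ℕ) (a b : ℕ × ℕ) : Op N := ket_bra N a b - ket_bra N b a

/-- The energy gap `μₙ = Eₙ₊₁ - Eₙ`. -/
def μ (E : ℕ → ℝ) (n : ℕ) : ℝ := E (n + 1) - E n

/-- The dynamical Lie algebra `L₀`: the real Lie algebra generated by `i H₀` and `i H_I`. -/
def L₀ (N : ℕ) (E : ℕ → ℝ) (d : ℕ × ℕ → ℕ × ℕ → ℝ) : LieSubalgebra ℝ (Op N) :=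
  LieSubalgebra.lieSpan ℝ (Op N) {Complex.I • H₀ N E, Complex.I • HI N d}

/-- The real Lie algebra of traceless skew-Hermitian operators; it is `su(2N-1)`, as
`states N` has `2N-1` elements. -/
def su (N : ℕ) : LieSubalgebra ℝ (Op N) where
  carrier := {A | Aᴴ = -A ∧ A.trace = 0}
  zero_mem' := by simp
  add_mem' := by
    rintro A B ⟨hA, hA'⟩ ⟨hB, hB'⟩
    refine ⟨?_, by simp [hA', hB']⟩
    rw [conjTranspose_add, hA, hB, neg_add]
  smul_mem' := by
    rintro c A ⟨hA, hA'⟩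
    exact ⟨by rw [conjTranspose_smul, hA]; simp, by simp [hA']⟩
  lie_mem' := by
    rintro A B ⟨hA, -⟩ ⟨hB, -⟩
    refine ⟨?_, ?_⟩
    · rw [Ring.lie_def, conjTranspose_sub, conjTranspose_mul, conjTranspose_mul, hA, hB]
      simp
    · rw [Ring.lie_def, trace_sub, trace_mul_comm, sub_self]

/-- The time evolution operators of `H = H₀ + f(t) H_I` (with `ħ = 1`) that are produced by
piecewise constant real control fields `f` on intervals `[0, T]`, `T ≥ 0`: the finite products of
factors `exp(-i t (H₀ + c H_I))`, where the field takes the value `c` for a duration `t ≥ 0`. -/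
def reachable (N : ℕ) (E : ℕ → ℝ) (d : ℕ × ℕ → ℕ × ℕ → ℝ) : Submonoid (Op N) :=
  Submonoid.closure {U | ∃ t : ℝ, 0 ≤ t ∧ ∃ c : ℝ,
    U = NormedSpace.exp ((-Complex.I * (t : ℂ)) • (H₀ N E + (c : ℂ) • HI N d))}

/-- Complete controllability by the single field `f`: every special unitary operator is the time
evolution operator, at some finite time, for a suitable control field. (Unitary operators matter
only up to a global phase, and any unit vector is mapped to any other one by a special unitary
operator, so this includes steering each initial state to each target state.) -/
def CompletelyControllable (N : ℕ) (E : ℕ → ℝ) (d : ℕ × ℕ → ℕ × ℕ → ℝ) : Prop :=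
  ∀ U ∈ Matrix.specialUnitaryGroup (states N) ℂ, U ∈ reachable N E d

end

end DegenerateControl

/-! ### Monoids of unitaries: smooth families inside the monoid and their directions. -/

namespace DegenerateControl

open Filter Topology NormedSpace

section Semigroup

variable {𝔸 : Type*} [NormedRing 𝔸]

/-! Algebra. Write g for the ground state and study the vectors a with |a⟩⟨g| - |g⟩⟨a| in L₀
(`couplings`). Double brackets with iH₀ multiply matrix entries by squared energy differences, so by
interpolation any real function of these may be applied entrywise (`spectral_filter_mem`). As μ₁ is
unlike the other gaps, this splits H_I into its transitions from g and a rest H' with H'g = 0. The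
first part says that i·v is a coupling, v = (d_{11,21}, d_{11,22}) on level 2; bracketing with iH'
applies iH' to couplings, and filtering again isolates single levels. Going from v up to level 3, at
(p, q), and back gives a second vector on level 2; the hypothesis on p, q is that the two are
independent. The determinant conditions then carry all of level n to level n + 1. So every vector
orthogonal to g is a coupling, and brackets of couplings yield su (`mem_of_skew_of_trace_eq_zero`).

Control. Let S be the monoid of reachable unitaries. Its closure is compact, hence a group, so
backward evolutions are limits of forward ones. A product of evolutions with varying durations whose
space of directions is maximal has directions containing the whole Lie algebra generated
(`exists_isDirectionSpace_conj_mem`, `lieSpan_le_of_conj_mem`). The implicit function theorem then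
gives S interior, first near some g in S, then near 1 (`eventually_mem_of_lieSpan_sup_eq_top`).
Roots of special unitaries tend to 1, so S contains them all. -/

theorem isClosed_coe_unitary [StarRing 𝔸] [CStarRing 𝔸] : IsClosed (unitary 𝔸 : Set 𝔸) := by
  have h : (unitary 𝔸 : Set 𝔸) = {x | star x * x = 1} ∩ {x | x * star x = 1} := by
    ext x; exact Unitary.mem_iff
  rw [h]
  exact (isClosed_eq (by fun_prop) (by fun_prop)).inter (isClosed_eq (by fun_prop) (by fun_prop))

variable [NormedAlgebra ℝ 𝔸]

theorem exp_smul_commute (a : 𝔸) (t : ℝ) : exp (t • a) * a = a * exp (t • a) :=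
  ((Commute.refl a).smul_left t).exp_left

/-- `V` consists of infinitesimal directions, translated to the identity, of a smooth family in
`S`. -/
def IsDirectionSpace (S : Submonoid 𝔸) (V : Submodule ℝ 𝔸) : Prop :=
  ∃ (E : Type) (_ : NormedAddCommGroup E) (_ : NormedSpace ℝ E) (_ : CompleteSpace E)
    (F : E → 𝔸) (F' : E →L[ℝ] 𝔸), HasStrictFDerivAt F F' 0 ∧ (∀ᶠ t in 𝓝 0, F t ∈ S) ∧
    ∀ v ∈ V, ∃ e, F' e = v * F 0

theorem isDirectionSpace_bot (S : Submonoid 𝔸) : IsDirectionSpace S ⊥ := by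
  refine ⟨ℝ, inferInstance, inferInstance, inferInstance, fun _ => 1, 0,
    hasStrictFDerivAt_const _ _, Eventually.of_forall fun _ => S.one_mem, ?_⟩
  intro v hv
  exact ⟨0, by simp [(Submodule.mem_bot ℝ).1 hv]⟩

variable [StarRing 𝔸]

theorem isCompact_of_isClosed_subset_unitary [CStarRing 𝔸] [FiniteDimensional ℝ 𝔸] {K : Set 𝔸}
    (hK : IsClosed K) (h : K ⊆ unitary 𝔸) : IsCompact K := by
  have : ProperSpace 𝔸 := FiniteDimensional.proper ℝ 𝔸
  refine Metric.isCompact_of_isClosed_isBounded hK ?_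
  rcases subsingleton_or_nontrivial 𝔸 with _ | _
  · exact K.toFinite.isBounded
  · refine (Metric.isBounded_closedBall (x := (0 : 𝔸)) (r := 1)).subset fun x hx => ?_
    simpa using (CStarRing.norm_of_mem_unitary (h hx)).le

/-- A closed monoid of unitaries in finite dimension is a group. -/
theorem star_mem_of_isClosed_of_le_unitary [CStarRing 𝔸] [FiniteDimensional ℝ 𝔸] {K : Submonoid 𝔸}
    (hK : IsClosed (K : Set 𝔸)) (h : K ≤ unitary 𝔸) {k : 𝔸} (hk : k ∈ K) : star k ∈ K := by
  have hc := isCompact_of_isClosed_subset_unitary hK h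
  obtain ⟨e, ⟨x, hx, rfl⟩, he⟩ := exists_idempotent_in_compact_subsemigroup
    (M := 𝔸) (fun r => by fun_prop) ((fun x => k * x) '' K) ⟨k * 1, 1, K.one_mem, rfl⟩
    (hc.image (by fun_prop)) (by
      rintro _ ⟨x, hx, rfl⟩ _ ⟨z, hz, rfl⟩
      exact ⟨x * (k * z), K.mul_mem hx (K.mul_mem hk hz), by simp [mul_assoc]⟩)
  have hu := Unitary.mem_iff.1 (h (K.mul_mem hk hx))
  have h1 : k * x = 1 := by
    calc k * x = star (k * x) * ((k * x) * (k * x)) := by rw [← mul_assoc, hu.1, one_mul]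
      _ = 1 := by
        have he' : (k * x) * (k * x) = k * x := he
        rw [he', hu.1]
  have h2 : star k = x := by
    calc star k = star k * (k * x) := by rw [h1, mul_one]
      _ = x := by rw [← mul_assoc, (Unitary.mem_iff.1 (h hk)).1, one_mul]
  rwa [h2]

/-- Right multiplication of the family by s · exp((1+τ)a), with τ a new parameter, keeps the old
directions, which are translated from the right. The derivative in τ adds the conjugate of a by gs,
where g is the base point of the old family. The duration is centred at 1, not 0, so that it stays
nonnegative for τ of either sign. -/
theorem IsDirectionSpace.exists_sup_span [CompleteSpace 𝔸] {S : Submonoid 𝔸} (hS : S ≤ unitary 𝔸)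
    {V : Submodule ℝ 𝔸} (hV : IsDirectionSpace S V) :
    ∃ g ∈ S, ∀ s ∈ S, ∀ a : 𝔸, (∀ t : ℝ, 0 ≤ t → exp (t • a) ∈ S) →
      IsDirectionSpace S (V ⊔ Submodule.span ℝ {(g * s) * a * star (g * s)}) := by
  obtain ⟨E, _, _, _, F, F', hF, hFS, hr⟩ := hV
  refine ⟨F 0, hFS.self_of_nhds, fun s hs a ha => ?_⟩
  have hg : F 0 ∈ S := hFS.self_of_nhds
  have hexp : HasStrictFDerivAt (fun x : E × ℝ => exp ((1 + x.2) • a))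
      ((ContinuousLinearMap.toSpanSingleton ℝ (a * exp ((1 : ℝ) • a))).comp
        (ContinuousLinearMap.snd ℝ E ℝ)) ((0 : E), (0 : ℝ)) := by
    have h1 : HasStrictDerivAt (fun u : ℝ => exp (u • a)) (a * exp ((1 : ℝ) • a)) (1 + 0) := by
      rw [add_zero]; exact hasStrictDerivAt_exp_smul_const' a (1 : ℝ)
    have h2 : HasStrictDerivAt (fun u : ℝ => exp ((1 + u) • a)) (a * exp ((1 : ℝ) • a)) 0 := by
      have h3 : HasStrictDerivAt (fun u : ℝ => 1 + u) 1 0 :=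
        (hasStrictDerivAt_id (0 : ℝ)).const_add 1
      simpa [Function.comp_def] using h1.scomp 0 h3
    exact HasStrictFDerivAt.comp ((0 : E), (0 : ℝ)) (f := Prod.snd)
      (g := fun u : ℝ => exp ((1 + u) • a)) h2.hasStrictFDerivAt hasStrictFDerivAt_snd
  have hF1 : HasStrictFDerivAt (fun x : E × ℝ => F x.1)
      (F'.comp (ContinuousLinearMap.fst ℝ E ℝ)) ((0 : E), (0 : ℝ)) :=
    HasStrictFDerivAt.comp ((0 : E), (0 : ℝ)) (f := Prod.fst) (g := F) hF hasStrictFDerivAt_fst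
  have hprod := (hF1.mul_const' s).mul' hexp
  refine ⟨E × ℝ, inferInstance, inferInstance, inferInstance, _, _, hprod, ?_, ?_⟩
  · have e1 : ∀ᶠ x : E × ℝ in 𝓝 0, F x.1 ∈ S :=
      (continuous_fst.tendsto (0 : E × ℝ)).eventually hFS
    have e2 : ∀ᶠ x : E × ℝ in 𝓝 0, -1 < x.2 :=
      (continuous_snd.tendsto (0 : E × ℝ)).eventually (lt_mem_nhds (by simp))
    filter_upwards [e1, e2] with x h1 h2
    exact S.mul_mem (S.mul_mem h1 hs) (ha _ (by linarith))
  · intro v hv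
    obtain ⟨w, hw, z, hz, rfl⟩ := Submodule.mem_sup.1 hv
    obtain ⟨c, rfl⟩ := Submodule.mem_span_singleton.1 hz
    obtain ⟨e, he⟩ := hr w hw
    refine ⟨(e, c), ?_⟩
    have hu := (Unitary.mem_iff.1 (hS (S.mul_mem hg hs))).1
    have hu' : star s * (star (F 0) * (F 0 * s)) = 1 := by
      rw [← mul_assoc, ← star_mul]; exact hu
    have hc := exp_smul_commute a 1
    rw [one_smul] at hc
    simp [he, add_mul, mul_assoc]
    rw [← mul_assoc (F 0) s (exp a), ← mul_assoc (star (F 0)), ← mul_assoc (star s), hu', one_mul]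
    abel

end Semigroup

end DegenerateControl

/-! ### From the generated Lie algebra to a neighbourhood of the identity. -/

namespace DegenerateControl

open Filter Topology NormedSpace

section Semigroup

variable {𝔸 : Type*} [NormedRing 𝔸] [NormedAlgebra ℝ 𝔸] 

/-- A subspace stable under conjugation by `exp (t • a)` is stable under `⁅a, ·⁆`. -/
theorem lie_mem_of_exp_conj_mem [FiniteDimensional ℝ 𝔸] {W : Submodule ℝ 𝔸} {a w : 𝔸}
    (h : ∀ t : ℝ, exp (t • a) * w * exp ((-t) • a) ∈ W) : ⁅a, w⁆ ∈ W := by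
  have : CompleteSpace 𝔸 := FiniteDimensional.complete ℝ 𝔸
  have h1 : HasDerivAt (fun t : ℝ => exp (t • a)) a 0 := by
    simpa using hasDerivAt_exp_smul_const' a (0 : ℝ)
  have h2 : HasDerivAt (fun t : ℝ => exp ((-t) • a)) (-a) 0 := by
    have := hasDerivAt_exp_smul_const' (-a) (0 : ℝ)
    simpa using this
  have h3 : HasDerivAt (fun t : ℝ => exp (t • a) * w * exp ((-t) • a)) ⁅a, w⁆ 0 := by
    have := (h1.mul_const w).mul h2
    simpa [Ring.lie_def, sub_eq_add_neg, Pi.mul_def] using this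
  have h4 := hasDerivAt_iff_tendsto_slope.1 h3
  refine (W.closed_of_finiteDimensional).mem_of_tendsto h4 (Eventually.of_forall fun t => ?_)
  rw [slope_def_module]
  exact W.smul_mem _ (W.sub_mem (h t) (h 0))

/-- By the Jacobi identity the elements of W that bracket W into W form a Lie subalgebra. -/
theorem lieSpan_le_of_lie_mem {𝒜 : Set 𝔸} {W : Submodule ℝ 𝔸} (hA : 𝒜 ⊆ W)
    (h : ∀ a ∈ 𝒜, ∀ w ∈ W, ⁅a, w⁆ ∈ W) : (LieSubalgebra.lieSpan ℝ 𝔸 𝒜).toSubmodule ≤ W := by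
  let N : LieSubalgebra ℝ 𝔸 :=
    { carrier := {x | x ∈ W ∧ ∀ w ∈ W, ⁅x, w⁆ ∈ W}
      zero_mem' := ⟨W.zero_mem, fun w _ => by simp⟩
      add_mem' := fun {x z} hx hz => ⟨W.add_mem hx.1 hz.1, fun w hw => by
        rw [add_lie]; exact W.add_mem (hx.2 w hw) (hz.2 w hw)⟩
      smul_mem' := fun c x hx => ⟨W.smul_mem c hx.1, fun w hw => by
        rw [smul_lie]; exact W.smul_mem c (hx.2 w hw)⟩
      lie_mem' := fun {x z} hx hz => ⟨hx.2 z hz.1, fun w hw => by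
        rw [lie_lie]
        exact W.sub_mem (hx.2 _ (hz.2 w hw)) (hz.2 _ (hx.2 w hw))⟩ }
  have : LieSubalgebra.lieSpan ℝ 𝔸 𝒜 ≤ N :=
    LieSubalgebra.lieSpan_le.2 fun a ha => ⟨hA ha, h a ha⟩
  exact fun x hx => (this hx).1

theorem topologicalClosure_le_unitary {𝔸 : Type*} [NormedRing 𝔸] [StarRing 𝔸] [CStarRing 𝔸]
    {S : Submonoid 𝔸} (hS : S ≤ unitary 𝔸) :
    S.topologicalClosure ≤ unitary 𝔸 :=
  S.topologicalClosure_minimal hS isClosed_coe_unitary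

variable [FiniteDimensional ℝ 𝔸] [StarRing 𝔸] [CStarRing 𝔸]

theorem star_mem_topologicalClosure {S : Submonoid 𝔸} (hS : S ≤ unitary 𝔸) {k : 𝔸}
    (hk : k ∈ S.topologicalClosure) : star k ∈ S.topologicalClosure :=
  star_mem_of_isClosed_of_le_unitary S.isClosed_topologicalClosure
    (topologicalClosure_le_unitary hS) hk

/-- Take V maximal: it already contains the conjugates of a by gs for all s in S, since otherwise
`exists_sup_span` would enlarge it. This closed condition passes to limits of s, and every k in the
closure has the form g(g⁻¹k) because the closure is a group. -/
theorem exists_isDirectionSpace_conj_mem {S : Submonoid 𝔸} (hS : S ≤ unitary 𝔸) {𝒜 : Set 𝔸}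
    (hexp : ∀ a ∈ 𝒜, ∀ t : ℝ, 0 ≤ t → exp (t • a) ∈ S) :
    ∃ V, IsDirectionSpace S V ∧ ∀ k ∈ S.topologicalClosure, ∀ a ∈ 𝒜, k * a * star k ∈ V := by
  have : CompleteSpace 𝔸 := FiniteDimensional.complete ℝ 𝔸
  obtain ⟨V, hV, hmax⟩ := (wellFounded_gt (α := Submodule ℝ 𝔸)).has_min
    {V | IsDirectionSpace S V} ⟨⊥, isDirectionSpace_bot S⟩
  refine ⟨V, hV, fun k hk a ha => ?_⟩
  obtain ⟨g, hg, hstep⟩ := hV.exists_sup_span hS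
  have hcl : IsClosed {s : 𝔸 | (g * s) * a * star (g * s) ∈ V} :=
    (V.closed_of_finiteDimensional).preimage (by fun_prop)
  have hsub : (S : Set 𝔸) ⊆ {s : 𝔸 | (g * s) * a * star (g * s) ∈ V} := by
    intro s hs
    by_contra hn
    refine hmax _ (hstep s hs a (hexp a ha)) (lt_of_le_of_ne le_sup_left fun he => hn ?_)
    change _ ∈ V
    rw [he]
    exact Submodule.mem_sup_right (Submodule.mem_span_singleton_self _)
  have hg' : g ∈ S.topologicalClosure := S.le_topologicalClosure hg
  have hmem : star g * k ∈ closure (S : Set 𝔸) :=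
    S.topologicalClosure.mul_mem (star_mem_topologicalClosure hS hg') hk
  have := closure_minimal hsub hcl hmem
  have h1 : g * (star g * k) = k := by
    rw [← mul_assoc, (Unitary.mem_iff.1 (hS hg)).2, one_mul]
  change (g * (star g * k)) * a * star (g * (star g * k)) ∈ V at this
  rwa [h1] at this

theorem exp_smul_mem_topologicalClosure {S : Submonoid 𝔸} (hS : S ≤ unitary 𝔸) {a : 𝔸}
    (ha : ∀ t : ℝ, 0 ≤ t → exp (t • a) ∈ S) (t : ℝ) :
    exp (t • a) ∈ S.topologicalClosure ∧ star (exp (t • a)) = exp ((-t) • a) := by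
  have : CompleteSpace 𝔸 := FiniteDimensional.complete ℝ 𝔸
  let _ : NormedAlgebra ℚ 𝔸 := .restrictScalars ℚ ℝ 𝔸
  have key : ∀ t : ℝ, 0 ≤ t → star (exp (t • a)) = exp ((-t) • a) := by
    intro t ht
    have h1 : exp (t • a) * exp ((-t) • a) = 1 := by
      rw [← exp_add_of_commute (((Commute.refl a).smul_left t).smul_right (-t)), ← add_smul]
      simp
    calc star (exp (t • a)) = star (exp (t • a)) * (exp (t • a) * exp ((-t) • a)) := by
          rw [h1, mul_one]
      _ = _ := by rw [← mul_assoc, (Unitary.mem_iff.1 (hS (ha t ht))).1, one_mul]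
  rcases le_total 0 t with ht | ht
  · exact ⟨S.le_topologicalClosure (ha t ht), key t ht⟩
  · have h1 := key (-t) (by linarith)
    rw [neg_neg] at h1
    refine ⟨?_, by rw [← h1, star_star]⟩
    rw [← h1]
    exact star_mem_topologicalClosure hS (S.le_topologicalClosure (ha _ (by linarith)))

/-- The span of all conjugates is stable under conjugation by the closure of S, which contains
exp(ta) for both signs of t. Differentiation at t = 0 makes it stable under bracketing with a. -/
theorem lieSpan_le_of_conj_mem {S : Submonoid 𝔸} (hS : S ≤ unitary 𝔸) {𝒜 : Set 𝔸}
    (hexp : ∀ a ∈ 𝒜, ∀ t : ℝ, 0 ≤ t → exp (t • a) ∈ S) {V : Submodule ℝ 𝔸}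
    (hV : ∀ k ∈ S.topologicalClosure, ∀ a ∈ 𝒜, k * a * star k ∈ V) :
    (LieSubalgebra.lieSpan ℝ 𝔸 𝒜).toSubmodule ≤ V := by
  set W : Submodule ℝ 𝔸 :=
    Submodule.span ℝ {x | ∃ k ∈ S.topologicalClosure, ∃ a ∈ 𝒜, x = k * a * star k} with hW
  have hWV : W ≤ V := by
    refine Submodule.span_le.2 ?_
    rintro _ ⟨k, hk, a, ha, rfl⟩
    exact hV k hk a ha
  have hconj : ∀ k ∈ S.topologicalClosure, ∀ w ∈ W, k * w * star k ∈ W := by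
    intro k hk w hw
    induction hw using Submodule.span_induction with
    | mem x hx =>
      obtain ⟨l, hl, a, ha, rfl⟩ := hx
      exact Submodule.subset_span ⟨k * l, mul_mem hk hl, a, ha, by simp [mul_assoc]⟩
    | zero => simp
    | add x z _ _ hx hz => rw [mul_add, add_mul]; exact W.add_mem hx hz
    | smul c x _ hx => rw [mul_smul_comm, smul_mul_assoc]; exact W.smul_mem c hx
  refine le_trans (lieSpan_le_of_lie_mem ?_ ?_) hWV
  · intro a ha
    exact Submodule.subset_span ⟨1, one_mem _, a, ha, by simp⟩
  · intro a ha w hw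
    refine lie_mem_of_exp_conj_mem fun t => ?_
    obtain ⟨h1, h2⟩ := exp_smul_mem_topologicalClosure hS (hexp a ha) t
    rw [← h2]
    exact hconj _ h1 w hw

/-- A monoid of unitaries that contains the positive one-parameter semigroups of a set `𝒜`
contains a neighbourhood of `1` in any group `G ⊇ S` that is locally complementary to a
complement of the Lie algebra generated by `𝒜`. -/
theorem eventually_mem_of_lieSpan_sup_eq_top {S : Submonoid 𝔸} (hS : S ≤ unitary 𝔸) {𝒜 : Set 𝔸}
    (hexp : ∀ a ∈ 𝒜, ∀ t : ℝ, 0 ≤ t → exp (t • a) ∈ S) {G : Submonoid 𝔸} (hSG : S ≤ G)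
    (hGstar : ∀ x ∈ G, star x ∈ G) {P : Submodule ℝ 𝔸}
    (hsup : (LieSubalgebra.lieSpan ℝ 𝔸 𝒜).toSubmodule ⊔ P = ⊤)
    (hP : ∀ᶠ x in 𝓝 (0 : 𝔸), x ∈ P → exp x ∈ G → x = 0) :
    ∀ᶠ U in 𝓝 (1 : 𝔸), U ∈ G → U ∈ S := by
  have : CompleteSpace 𝔸 := FiniteDimensional.complete ℝ 𝔸
  have : CompleteSpace P := FiniteDimensional.complete ℝ P
  obtain ⟨V, ⟨E, _, _, _, F, F', hF, hFS, hr⟩, hVK⟩ := exists_isDirectionSpace_conj_mem hS hexp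
  have hLV := lieSpan_le_of_conj_mem hS hexp hVK
  set g := F 0 with hg
  have hgS : g ∈ S := hFS.self_of_nhds
  have hu := Unitary.mem_iff.1 (hS hgS)
  have hFfst : HasStrictFDerivAt (fun x : E × P => F x.1)
      (F'.comp (ContinuousLinearMap.fst ℝ E P)) ((0 : E), (0 : P)) :=
    HasStrictFDerivAt.comp ((0 : E), (0 : P)) (f := Prod.fst) (g := F) hF hasStrictFDerivAt_fst
  have hexpP : HasStrictFDerivAt (fun x : E × P => exp (x.2 : 𝔸))
      (P.subtypeL.comp (ContinuousLinearMap.snd ℝ E P)) ((0 : E), (0 : P)) := by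
    have h0 : HasStrictFDerivAt (exp : 𝔸 → 𝔸) (1 : 𝔸 →L[ℝ] 𝔸)
        ((P.subtypeL.comp (ContinuousLinearMap.snd ℝ E P)) ((0 : E), (0 : P))) := by
      simpa using hasStrictFDerivAt_exp_zero (𝕂 := ℝ) (𝔸 := 𝔸)
    exact h0.comp ((0 : E), (0 : P))
      (P.subtypeL.comp (ContinuousLinearMap.snd ℝ E P)).hasStrictFDerivAt
  have hprod := hexpP.mul' hFfst
  have h0 : exp (((0 : P) : P) : 𝔸) * F 0 = g := by simp [hg]
  -- The directions of F cover the Lie algebra and P the rest, so the derivative is onto and the map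
  -- is open at the base point.
  have hmap : map (fun x : E × P => exp (x.2 : 𝔸) * F x.1) (𝓝 (0, 0)) = 𝓝 g := by
    rw [← h0]
    exact hprod.map_nhds_eq_of_surj (by
    rw [eq_top_iff]
    intro z _
    have hz : z * star g ∈ (LieSubalgebra.lieSpan ℝ 𝔸 𝒜).toSubmodule ⊔ P := by
      rw [hsup]; trivial
    obtain ⟨l, hl, p, hp, hlp⟩ := Submodule.mem_sup.1 hz
    obtain ⟨e, he⟩ := hr l (hLV hl)
    refine ⟨(e, ⟨p, hp⟩), ?_⟩
    have : l * g + p * g = z := by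
      rw [← add_mul, hlp, mul_assoc, hu.1, mul_one]
    simpa [he, ← hg] using this)
  have hnear : ∀ᶠ U in 𝓝 g, U ∈ G → U ∈ S := by
    rw [← hmap, eventually_map]
    have e1 : ∀ᶠ x : E × P in 𝓝 (0, 0), F x.1 ∈ S :=
      (continuous_fst.tendsto ((0 : E), (0 : P))).eventually hFS
    have e2 : ∀ᶠ x : E × P in 𝓝 (0, 0), (x.2 : 𝔸) ∈ P → exp (x.2 : 𝔸) ∈ G → (x.2 : 𝔸) = 0 := by
      have hc : Continuous fun x : E × P => (x.2 : 𝔸) := by fun_prop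
      exact (hc.tendsto ((0 : E), (0 : P))).eventually (by simpa using hP)
    -- If exp(p)F(e) lies in G, so does exp(p), hence p = 0 and the point is F(e) itself, in S.
    filter_upwards [e1, e2] with x h1 h2 hx
    have h3 : exp (x.2 : 𝔸) ∈ G := by
      have := G.mul_mem hx (hGstar _ (hSG h1))
      rwa [mul_assoc, (Unitary.mem_iff.1 (hS h1)).2, mul_one] at this
    rw [h2 x.2.2 h3, exp_zero, one_mul]
    exact h1
  -- Translating from g to 1 uses g⁻¹, which is so far known only to lie in the closure of S.
  have hcl : ∀ᶠ U in 𝓝 (1 : 𝔸), U ∈ G → U ∈ S.topologicalClosure := by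
    have hc : Continuous fun U : 𝔸 => g * U := by fun_prop
    have := (hc.tendsto 1).eventually (by simpa using hnear)
    filter_upwards [this] with U hU hUG
    have h1 := S.topologicalClosure.mul_mem
      (star_mem_topologicalClosure hS (S.le_topologicalClosure hgS))
      (S.le_topologicalClosure (hU (G.mul_mem (hSG hgS) hUG)))
    rwa [← mul_assoc, hu.1, one_mul] at h1
  -- To remove the closure, choose s in S near Ug⁻¹. Then s⁻¹U is near g, hence in S, and U =
  -- s(s⁻¹U).
  filter_upwards [hcl] with U hU hUG
  have hUK := hU hUG
  have hV : U * star g ∈ closure (S : Set 𝔸) :=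
    S.topologicalClosure.mul_mem hUK
      (star_mem_topologicalClosure hS (S.le_topologicalClosure hgS))
  have hUu := Unitary.mem_iff.1 (topologicalClosure_le_unitary hS hUK)
  have hc : Continuous fun s : 𝔸 => star s * U := by fun_prop
  have hev : ∀ᶠ s in 𝓝 (U * star g), star s * U ∈ G → star s * U ∈ S :=
    (hc.tendsto (U * star g)).eventually (by
      rwa [star_mul, star_star, mul_assoc, hUu.1, mul_one])
  obtain ⟨s, hs, hsS⟩ := ((mem_closure_iff_frequently.1 hV).and_eventually hev).exists
  have h1 := S.mul_mem hs (hsS (G.mul_mem (hGstar _ (hSG hs)) hUG))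
  rwa [← mul_assoc, (Unitary.mem_iff.1 (hS hs)).2, one_mul] at h1

end Semigroup

end DegenerateControl

/-! ### Exponentials and logarithms of unitary matrices. -/

namespace DegenerateControl

open Filter Topology NormedSpace Matrix

section Unitary

/-- exp x is both self-adjoint and unitary, so exp(2x) = 1, and the logarithm is injective here.
This makes Hermitian directions transversal to the unitary group. -/
theorem eq_zero_of_exp_mem_unitary {A : Type*} [CStarAlgebra A] {x : A} (hx : IsSelfAdjoint x)
    (h : exp x ∈ unitary A) : x = 0 := by
  let _ : NormedAlgebra ℚ A := .restrictScalars ℚ ℂ A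
  have h1 : exp (x + x) = 1 := by
    rw [exp_add_of_commute (Commute.refl x)]
    have := (Unitary.mem_iff.1 h).1
    rwa [star_exp, hx.star_eq] at this
  have h2 := CFC.log_exp (x + x) (hx.add hx)
  rw [h1, CFC.log_one] at h2
  have h3 : (2 : ℂ) • x = 0 := by rw [two_smul, ← h2]
  exact (smul_eq_zero.1 h3).resolve_left two_ne_zero

variable {n : Type*} [Fintype n] [DecidableEq n]

open scoped Matrix.Norms.L2Operator in
-- h is the argument of U in the functional calculus; the branch cut is harmless because the
-- spectrum is finite.
theorem exists_exp_eq_of_mem_unitaryGroup {U : Matrix n n ℂ} (hU : U ∈ unitaryGroup n ℂ) :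
    ∃ h : Matrix n n ℂ, h.IsHermitian ∧ exp (Complex.I • h) = U := by
  have hnormal : IsStarNormal U := ⟨by
    have := Unitary.mem_iff.1 hU
    rw [Commute, SemiconjBy, this.1, this.2]⟩
  have hfin : (spectrum ℂ U).Finite := Matrix.finite_spectrum U
  refine ⟨cfc (Complex.ofReal ∘ Complex.arg) U, IsSelfAdjoint.cfc_arg U, ?_⟩
  have hc : ContinuousOn (Complex.ofReal ∘ Complex.arg) (spectrum ℂ U) := hfin.continuousOn _
  rw [← CFC.exp_eq_normedSpace_exp (𝕜 := ℂ), ← cfc_comp_smul .., ← cfc_comp' ..]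
  conv_rhs => rw [← cfc_id' ℂ U]
  refine cfc_congr fun y hy ↦ ?_
  have hy₁ : ‖y‖ = 1 := spectrum.norm_eq_one_of_unitary hU hy
  have : Complex.I * y.arg = Complex.log y :=
    Complex.ext (by simp [Complex.log_re, hy₁]) (by simp [Complex.log_im])
  have hy0 : y ≠ 0 := by rintro rfl; simp at hy₁
  simpa [← Complex.exp_eq_exp_ℂ, this] using Complex.exp_log hy0

theorem exp_unitary_conj_diagonal {V : Matrix n n ℂ} (hV : V ∈ unitaryGroup n ℂ) (v : n → ℂ) :
    exp (V * diagonal v * star V) = V * diagonal (fun i => Complex.exp (v i)) * star V := by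
  have h1 := Unitary.mem_iff.1 hV
  have hinv : V⁻¹ = star V := inv_eq_left_inv h1.1
  rw [← hinv, exp_conj _ _ ⟨⟨V, star V, h1.2, h1.1⟩, rfl⟩, exp_diagonal]
  congr 3
  ext i
  rw [Pi.coe_exp, Complex.exp_eq_exp_ℂ]

theorem det_unitary_conj_diagonal {V : Matrix n n ℂ} (hV : V ∈ unitaryGroup n ℂ) (v : n → ℂ) :
    (V * diagonal v * star V).det = ∏ i, v i := by
  rw [det_mul_right_comm, (Unitary.mem_iff.1 hV).2, one_mul, det_diagonal]

theorem trace_unitary_conj_diagonal {V : Matrix n n ℂ} (hV : V ∈ unitaryGroup n ℂ) (v : n → ℂ) :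
    (V * diagonal v * star V).trace = ∑ i, v i := by
  rw [trace_mul_comm, ← mul_assoc, (Unitary.mem_iff.1 hV).1, one_mul, trace_diagonal]

theorem exists_eq_unitary_conj_diagonal {h : Matrix n n ℂ} (hh : h.IsHermitian) :
    ∃ V ∈ unitaryGroup n ℂ, ∃ v : n → ℝ,
      h = V * diagonal (fun i => (v i : ℂ)) * star V := by
  refine ⟨hh.eigenvectorUnitary, hh.eigenvectorUnitary.2, hh.eigenvalues, ?_⟩
  conv_lhs => rw [hh.spectral_theorem]
  simp [Function.comp_def]

theorem smul_unitary_conj_diagonal (c : ℂ) (V : Matrix n n ℂ) (v : n → ℂ) :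
    c • (V * diagonal v * star V) = V * diagonal (fun i => c * v i) * star V := by
  rw [← smul_mul_assoc, ← mul_smul_comm, ← diagonal_smul]; rfl

theorem det_exp_I_smul {h : Matrix n n ℂ} (hh : h.IsHermitian) :
    (exp (Complex.I • h)).det = Complex.exp (Complex.I * h.trace) := by
  obtain ⟨V, hV, v, rfl⟩ := exists_eq_unitary_conj_diagonal hh
  rw [smul_unitary_conj_diagonal, exp_unitary_conj_diagonal hV, det_unitary_conj_diagonal hV,
    trace_unitary_conj_diagonal hV, ← Complex.exp_sum, Finset.mul_sum]

theorem exp_I_smul_mem_unitaryGroup {h : Matrix n n ℂ} (hh : h.IsHermitian) :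
    exp (Complex.I • h) ∈ unitaryGroup n ℂ := by
  have hs : star (exp (Complex.I • h)) = exp (-(Complex.I • h)) := by
    rw [star_exp, star_smul, star_eq_conjTranspose h, hh.eq]; simp
  have h1 : exp (Complex.I • h) * exp (-(Complex.I • h)) = 1 := by
    rw [← Matrix.exp_add_of_commute _ _ ((Commute.refl (Complex.I • h)).neg_right), add_neg_cancel, exp_zero]
  rw [mem_unitaryGroup_iff, hs, h1]

theorem exists_exp_eq_of_mem_specialUnitaryGroup [Nonempty n] {U : Matrix n n ℂ}
    (hU : U ∈ specialUnitaryGroup n ℂ) :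
    ∃ h : Matrix n n ℂ, h.IsHermitian ∧ h.trace = 0 ∧ exp (Complex.I • h) = U := by
  obtain ⟨hUu, hdet⟩ := mem_specialUnitaryGroup_iff.1 hU
  obtain ⟨h, hh, rfl⟩ := exists_exp_eq_of_mem_unitaryGroup hUu
  obtain ⟨V, hV, v, rfl⟩ := exists_eq_unitary_conj_diagonal hh
  obtain ⟨j⟩ := ‹Nonempty n›
  rw [det_exp_I_smul hh, trace_unitary_conj_diagonal hV] at hdet
  -- As det U = 1, the trace of h is a multiple of 2π. Subtracting all of it from one eigenvalue
  -- leaves the exponential unchanged.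
  set w : n → ℝ := fun i => v i - if i = j then ∑ i, v i else 0 with hw
  refine ⟨V * diagonal (fun i => (w i : ℂ)) * star V, ?_, ?_, ?_⟩
  · rw [IsHermitian, conjTranspose_mul, conjTranspose_mul, diagonal_conjTranspose,
      star_eq_conjTranspose, conjTranspose_conjTranspose, mul_assoc]
    congr 3
    ext i; simp
  · rw [trace_unitary_conj_diagonal hV]
    rw [← Complex.ofReal_sum]
    simp [hw, Finset.sum_sub_distrib]
  · rw [smul_unitary_conj_diagonal, smul_unitary_conj_diagonal, exp_unitary_conj_diagonal hV,
      exp_unitary_conj_diagonal hV]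
    congr 3
    ext i
    by_cases hij : i = j
    · simp only [hw, hij, if_true]
      push_cast
      rw [mul_sub, Complex.exp_sub, hdet, div_one]
    · simp [hw, hij]

end Unitary

end DegenerateControl

/-! ### The Lie algebra criterion for reaching the special unitary group. -/

namespace DegenerateControl

open Filter Topology NormedSpace Matrix

section Control

variable {n : Type*} [Fintype n] [DecidableEq n]

open scoped Matrix.Norms.L2Operator in
/-- The `L²` operator norm on complex matrices as a norm of real algebras, compatible with the
entrywise real scalar multiplication. -/
@[reducible] noncomputable def realNormedAlgebra : NormedAlgebra ℝ (Matrix n n ℂ) :=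
  { (inferInstance : Algebra ℝ (Matrix n n ℂ)) with
    norm_smul_le := fun r A => by
      have : r • A = (r : ℂ) • A := by ext i j; simp
      rw [this, norm_smul]; simp }

open scoped Matrix.Norms.L2Operator in
theorem specialUnitaryGroup_le_of_eventually [Nonempty n] {S : Submonoid (Matrix n n ℂ)}
    (h : ∀ᶠ U in 𝓝 (1 : Matrix n n ℂ), U ∈ specialUnitaryGroup n ℂ → U ∈ S) :
    specialUnitaryGroup n ℂ ≤ S := by
  intro U hU
  obtain ⟨h0, hh, htr, rfl⟩ := exists_exp_eq_of_mem_specialUnitaryGroup hU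
  have hlim : Tendsto (fun m : ℕ => exp (Complex.I • (((m : ℂ) + 1)⁻¹ • h0))) atTop (𝓝 1) := by
    have h1 : Tendsto (fun m : ℕ => ((m : ℂ) + 1)⁻¹) atTop (𝓝 0) := by
      simpa using tendsto_one_div_add_atTop_nhds_zero_nat (𝕜 := ℂ)
    have h2 : Continuous fun z : ℂ => exp (Complex.I • (z • h0)) := by
      have : Continuous (exp : Matrix n n ℂ → Matrix n n ℂ) := by
        let _ : NormedAlgebra ℚ (Matrix n n ℂ) := .restrictScalars ℚ ℂ _
        exact exp_continuous
      fun_prop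
    simpa [Function.comp_def] using (h2.tendsto 0).comp h1
  obtain ⟨m, hm⟩ := (hlim.eventually h).exists
  have hm0 : ((m : ℂ) + 1) ≠ 0 := Nat.cast_add_one_ne_zero m
  have hherm : ((((m : ℂ) + 1)⁻¹) • h0).IsHermitian := by
    rw [IsHermitian, conjTranspose_smul, hh.eq]; simp
  have hmem : exp (Complex.I • (((m : ℂ) + 1)⁻¹ • h0)) ∈ specialUnitaryGroup n ℂ := by
    refine mem_specialUnitaryGroup_iff.2 ⟨exp_I_smul_mem_unitaryGroup hherm, ?_⟩
    rw [det_exp_I_smul hherm, trace_smul, htr]; simp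
  have hpow := S.pow_mem (hm hmem) (m + 1)
  rw [← Matrix.exp_nsmul, ← Nat.cast_smul_eq_nsmul ℂ, smul_comm] at hpow
  push_cast at hpow
  rwa [smul_inv_smul₀ hm0] at hpow

open scoped Matrix.Norms.L2Operator in
theorem specialUnitaryGroup_le_of_lieSpan [Nonempty n] {S : Submonoid (Matrix n n ℂ)}
    {𝒜 : Set (Matrix n n ℂ)}
    (hexp : ∀ a ∈ 𝒜, ∀ t : ℝ, 0 ≤ t → exp (t • a) ∈ S)
    (hsu : ∀ A : Matrix n n ℂ, Aᴴ = -A → A.trace = 0 → A ∈ LieSubalgebra.lieSpan ℝ _ 𝒜)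
    (hS : S ≤ specialUnitaryGroup n ℂ ∨ S ≤ unitaryGroup n ℂ ∧
      ∃ T ∈ LieSubalgebra.lieSpan ℝ _ 𝒜, Tᴴ = -T ∧ T.trace ≠ 0) :
    specialUnitaryGroup n ℂ ≤ S := by
  let _ : NormedAlgebra ℝ (Matrix n n ℂ) := realNormedAlgebra
  have hcard : (Fintype.card n : ℂ) ≠ 0 := Nat.cast_ne_zero.2 Fintype.card_ne_zero
  have hre : ∀ A : Matrix n n ℂ, Aᴴ = -A → A.trace = (A.trace.im : ℂ) * Complex.I := by
    intro A hA
    have h1 := congrArg Matrix.trace hA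
    rw [trace_conjTranspose, trace_neg] at h1
    have h2 := congrArg Complex.re h1
    simp at h2
    apply Complex.ext
    · simp; linarith
    · simp
  have hdecomp : ∀ A : Matrix n n ℂ, ∃ B h : Matrix n n ℂ, Bᴴ = -B ∧ hᴴ = h ∧ A = B + h := by
    intro A
    refine ⟨(2⁻¹ : ℂ) • (A - Aᴴ), (2⁻¹ : ℂ) • (A + Aᴴ), ?_, ?_, ?_⟩
    · rw [conjTranspose_smul]; simp [← smul_neg]
    · rw [conjTranspose_smul]; simp [add_comm]
    · rw [← smul_add, sub_add_add_cancel, ← two_smul ℂ A, smul_smul]; simp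
  let P₀ : Submodule ℝ (Matrix n n ℂ) :=
    { carrier := {x | xᴴ = x}
      zero_mem' := by simp
      add_mem' := fun {x z} hx hz => by
        change (x + z)ᴴ = x + z
        rw [conjTranspose_add, hx, hz]
      smul_mem' := fun c x hx => by
        change (c • x)ᴴ = c • x
        rw [conjTranspose_smul, hx]; simp }
  rcases hS with hS | ⟨hS, T, hT, hTs, hT0⟩
  · have hSu : S ≤ unitary (Matrix n n ℂ) :=
      hS.trans fun U hU => (mem_specialUnitaryGroup_iff.1 hU).1
    -- A complement of su: Hermitian matrices together with the imaginary scalars.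
    let P : Submodule ℝ (Matrix n n ℂ) :=
      P₀ ⊔ Submodule.span ℝ {Complex.I • (1 : Matrix n n ℂ)}
    refine specialUnitaryGroup_le_of_eventually
      (eventually_mem_of_lieSpan_sup_eq_top hSu hexp hS ?_ (P := P) ?_ ?_)
    · intro x hx
      obtain ⟨h1, h2⟩ := mem_specialUnitaryGroup_iff.1 hx
      refine mem_specialUnitaryGroup_iff.2 ⟨Unitary.star_mem h1, ?_⟩
      rw [star_eq_conjTranspose, det_conjTranspose, h2, star_one]
    · rw [eq_top_iff]
      intro A _
      obtain ⟨B, h, hB, hh, rfl⟩ := hdecomp A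
      set r : ℝ := B.trace.im / Fintype.card n with hr
      have e : B + h = (B - r • (Complex.I • (1 : Matrix n n ℂ))) +
          (h + r • (Complex.I • (1 : Matrix n n ℂ))) := by abel
      rw [e]
      refine Submodule.add_mem_sup (hsu _ ?_ ?_)
        (Submodule.add_mem_sup hh (Submodule.smul_mem _ _ (Submodule.mem_span_singleton_self _)))
      · rw [conjTranspose_sub, hB, conjTranspose_smul, conjTranspose_smul]; simp; abel
      · rw [trace_sub, trace_smul, trace_smul, trace_one, hre B hB, hr]
        simp
        field_simp
        ring
    · have hc : Continuous fun x : Matrix n n ℂ => ‖x.trace‖ := by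
        refine continuous_norm.comp ?_
        exact continuous_id.matrix_trace
      -- An imaginary scalar iθ whose exponential has determinant 1 has trace in 2πiℤ; this bound
      -- leaves only 0.
      have hlt : ∀ᶠ x : Matrix n n ℂ in 𝓝 0, ‖x.trace‖ < 2 * Real.pi :=
        (hc.tendsto 0).eventually (gt_mem_nhds (by simp [Real.pi_pos]))
      filter_upwards [hlt] with x hx hxP hxe
      obtain ⟨h, hh, z, hz, rfl⟩ := Submodule.mem_sup.1 hxP
      obtain ⟨θ, rfl⟩ := Submodule.mem_span_singleton.1 hz
      have hh' : hᴴ = h := hh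
      have hθ : θ • (Complex.I • (1 : Matrix n n ℂ)) = Complex.I • ((θ : ℂ) • 1) := by
        ext i j; simp; ring
      have hherm : ((θ : ℂ) • (1 : Matrix n n ℂ)).IsHermitian := by
        rw [IsHermitian, conjTranspose_smul]; simp
      rw [hθ] at hxe hx ⊢
      have hcomm : Commute h (Complex.I • ((θ : ℂ) • (1 : Matrix n n ℂ))) :=
        ((Commute.one_right h).smul_right _).smul_right _
      rw [Matrix.exp_add_of_commute _ _ hcomm] at hxe
      obtain ⟨hxu, hxd⟩ := mem_specialUnitaryGroup_iff.1 hxe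
      have hu2 := exp_I_smul_mem_unitaryGroup hherm
      have h0 : h = 0 := by
        refine eq_zero_of_exp_mem_unitary hh' ?_
        have := mul_mem hxu (Unitary.star_mem hu2)
        rwa [mul_assoc, (Unitary.mem_iff.1 hu2).2, mul_one] at this
      subst h0
      rw [exp_zero, one_mul, det_exp_I_smul hherm] at hxd
      rw [zero_add, trace_smul, norm_smul, Complex.norm_I, one_mul, trace_smul, trace_one] at hx
      rw [trace_smul, trace_one, Complex.exp_eq_one_iff] at hxd
      obtain ⟨k, hk⟩ := hxd
      have hk' : (θ : ℂ) * Fintype.card n = (k * (2 * Real.pi) : ℝ) := by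
        apply mul_left_cancel₀ Complex.I_ne_zero
        rw [smul_eq_mul] at hk
        rw [hk]; push_cast; ring
      have hk0 : k = 0 := by
        rw [smul_eq_mul, hk', Complex.norm_real, Real.norm_eq_abs, abs_mul,
          abs_of_pos Real.two_pi_pos] at hx
        have : |(k : ℝ)| < 1 := by
          by_contra hcon
          nlinarith [Real.two_pi_pos]
        rw [← Int.cast_abs] at this
        exact Int.abs_lt_one_iff.1 (by exact_mod_cast this)
      have hθ0 : (θ : ℂ) = 0 := by
        rw [hk0] at hk'
        simpa [hcard] using hk'
      rw [hθ0]; simp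
  · refine specialUnitaryGroup_le_of_eventually ?_
    -- With T the Lie span contains all skew-Hermitian matrices, so the ambient group can be the
    -- full unitary group and Hermitian matrices suffice as complement.
    have key : ∀ᶠ U in 𝓝 (1 : Matrix n n ℂ), U ∈ unitaryGroup n ℂ → U ∈ S := by
      refine eventually_mem_of_lieSpan_sup_eq_top hS hexp hS
        (fun x hx => Unitary.star_mem hx) (P := P₀) ?_ ?_
      · rw [eq_top_iff]
        intro A _
        obtain ⟨B, h, hB, hh, rfl⟩ := hdecomp A
        refine Submodule.add_mem_sup ?_ hh
        set r : ℝ := B.trace.im / T.trace.im with hr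
        have hT1 : T.trace.im ≠ 0 := by
          intro h0
          rw [hre T hTs, h0] at hT0
          simp at hT0
        have e : B = (B - r • T) + r • T := by abel
        rw [e]
        refine Submodule.add_mem _ (hsu _ ?_ ?_) (Submodule.smul_mem _ _ hT)
        · rw [conjTranspose_sub, hB, conjTranspose_smul, hTs]; simp; abel
        · rw [trace_sub, trace_smul, hre B hB, hre T hTs, hr]
          have : (T.trace.im : ℂ) ≠ 0 := by exact_mod_cast hT1
          simp
          field_simp
          ring
      · exact Eventually.of_forall fun x hx hxe => eq_zero_of_exp_mem_unitary hx hxe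
    filter_upwards [key] with U hU hUs
    exact hU (mem_specialUnitaryGroup_iff.1 hUs).1

end Control

end DegenerateControl

/-! ### Couplings to one basis state, and how they generate su. -/

namespace DegenerateControl

open Matrix

section Transitions

variable {σ : Type*} [DecidableEq σ]

/-- The skew-Hermitian operator `|a⟩⟨g| - |g⟩⟨a|` for a vector `a` and a basis state `g`. -/
def skewKetBra (g : σ) (a : σ → ℂ) : Matrix σ σ ℂ :=
  Matrix.of fun i j => (if j = g then a i else 0) - (if i = g then star (a j) else 0)

theorem skewKetBra_add (g : σ) (a b : σ → ℂ) :
    skewKetBra g (a + b) = skewKetBra g a + skewKetBra g b := by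
  ext i j
  simp only [skewKetBra, of_apply, Matrix.add_apply, Pi.add_apply, star_add]
  split_ifs <;> ring

theorem skewKetBra_smul (g : σ) (r : ℝ) (a : σ → ℂ) :
    skewKetBra g (r • a) = r • skewKetBra g a := by
  ext i j
  simp only [skewKetBra, of_apply, Matrix.smul_apply, Pi.smul_apply, star_smul, star_trivial]
  split_ifs <;> simp [mul_sub]

/-- `skewKetBra` as a real-linear map. -/
noncomputable def skewKetBraₗ (g : σ) : (σ → ℂ) →ₗ[ℝ] Matrix σ σ ℂ where
  toFun := skewKetBra g
  map_add' := skewKetBra_add g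
  map_smul' := skewKetBra_smul g

/-- The vectors `a` for which `|a⟩⟨g| - |g⟩⟨a|` lies in `L`. -/
noncomputable def couplings [Fintype σ] (L : LieSubalgebra ℝ (Matrix σ σ ℂ)) (g : σ) : Submodule ℝ (σ → ℂ) :=
  L.toSubmodule.comap (skewKetBraₗ g)

variable [Fintype σ] {L : LieSubalgebra ℝ (Matrix σ σ ℂ)} {g : σ}

theorem mem_couplings {a : σ → ℂ} : a ∈ couplings L g ↔ skewKetBra g a ∈ L := Iff.rfl

theorem lie_diagonal_apply (ε : σ → ℝ) (T : Matrix σ σ ℂ) (i j : σ) :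
    ⁅Complex.I • diagonal (fun i => (ε i : ℂ)), T⁆ i j = Complex.I * (ε i - ε j) * T i j := by
  rw [Ring.lie_def, Matrix.sub_apply, smul_mul_assoc, mul_smul_comm, Matrix.smul_apply, Matrix.smul_apply,
    diagonal_mul, mul_diagonal]
  simp only [smul_eq_mul]; ring

/-- Minus the double bracket with the diagonal generator multiplies entry (i, j) by (εᵢ - εⱼ)².
Iteration gives every real polynomial in it, and on finitely many values f is a Lagrange polynomial.
Squares appear because a single bracket brings an imaginary factor. -/
theorem spectral_filter_mem {ε : σ → ℝ} (hε : Complex.I • diagonal (fun i => (ε i : ℂ)) ∈ L)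
    {T : Matrix σ σ ℂ} (hT : T ∈ L) (f : ℝ → ℝ) :
    (Matrix.of fun i j => (f ((ε i - ε j) ^ 2) : ℂ) * T i j) ∈ L := by
  have hpoly : ∀ P : Polynomial ℝ, ∀ T ∈ L,
      (Matrix.of fun i j => ((P.eval ((ε i - ε j) ^ 2) : ℝ) : ℂ) * T i j) ∈ L := by
    intro P
    induction P using Polynomial.induction_on' with
    | add p q hp hq =>
      intro T hT
      have := L.add_mem (hp T hT) (hq T hT)
      convert this using 1
      ext i j; simp [add_mul]
    | monomial m c =>
      induction m with
      | zero =>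
        intro T hT
        convert L.smul_mem c hT using 1
        ext i j; simp
      | succ m ih =>
        intro T hT
        have h2 := L.neg_mem (L.lie_mem hε (L.lie_mem hε hT))
        have := ih _ h2
        convert this using 1
        ext i j
        simp only [of_apply, Matrix.neg_apply, lie_diagonal_apply, Polynomial.eval_monomial]
        push_cast
        linear_combination (c * (((ε i : ℂ) - ε j) ^ 2) ^ (m + 1) * T i j) * Complex.I_sq
  set s : Finset ℝ := Finset.univ.image fun x : σ × σ => (ε x.1 - ε x.2) ^ 2 with hs
  convert hpoly (Lagrange.interpolate s id f) T hT using 1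
  ext i j
  simp only [of_apply]
  congr 2
  exact (Lagrange.eval_interpolate_at_node (v := id) f (Set.injOn_id _)
    (by exact Finset.mem_image.2 ⟨(i, j), Finset.mem_univ _, rfl⟩)).symm

theorem filter_mem_couplings {ε : σ → ℝ}
    (hε : Complex.I • diagonal (fun i => (ε i : ℂ)) ∈ L) {a : σ → ℂ} (ha : a ∈ couplings L g)
    (f : ℝ → ℝ) : (fun i => (f ((ε i - ε g) ^ 2) : ℂ) * a i) ∈ couplings L g := by
  rw [mem_couplings] at ha ⊢
  convert spectral_filter_mem hε ha f using 1
  ext i j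
  simp only [skewKetBra, of_apply]
  by_cases hi : i = g <;> by_cases hj : j = g
  · subst hi; subst hj; simp; ring
  · subst hi; simp [hj, sub_sq_comm (ε i) (ε j)]
  · subst hj; simp [hi]
  · simp [hi, hj]

theorem lie_diagonal_mem_couplings {ε : σ → ℝ}
    (hε : Complex.I • diagonal (fun i => (ε i : ℂ)) ∈ L) {a : σ → ℂ} (ha : a ∈ couplings L g) :
    (fun i => Complex.I * (ε i - ε g) * a i) ∈ couplings L g := by
  rw [mem_couplings] at ha ⊢
  convert L.lie_mem hε ha using 1
  ext i j
  rw [lie_diagonal_apply]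
  simp only [skewKetBra, of_apply]
  by_cases hi : i = g <;> by_cases hj : j = g
  · subst hi; subst hj; simp
  · subst hi; simp [hj]; ring
  · subst hj; simp [hi]
  · simp [hi, hj]

/-- As H kills the basis state g, bracketing with iH acts only on the vector a in |a⟩⟨g| - |g⟩⟨a|.
-/
theorem mulVec_mem_couplings {H : Matrix σ σ ℂ} (hH : Complex.I • H ∈ L) (hherm : H.IsHermitian)
    (hg : ∀ i, H i g = 0) {a : σ → ℂ} (ha : a ∈ couplings L g) :
    Complex.I • (H *ᵥ a) ∈ couplings L g := by
  rw [mem_couplings] at ha ⊢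
  convert L.lie_mem hH ha using 1
  have hg' : ∀ i, H g i = 0 := fun i => by rw [← hherm.apply, hg, star_zero]
  ext i j
  rw [Ring.lie_def, Matrix.sub_apply, smul_mul_assoc, mul_smul_comm, Matrix.smul_apply, Matrix.smul_apply,
    mul_apply, mul_apply]
  have h1 : ∑ k, H i k * skewKetBra g a k j = if j = g then (H *ᵥ a) i else 0 := by
    split_ifs with hj
    · subst hj
      refine Finset.sum_congr rfl fun k _ => ?_
      by_cases hk : k = j
      · subst hk; simp [hg]
      · simp [skewKetBra, hk]
    · refine Finset.sum_eq_zero fun k _ => ?_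
      by_cases hk : k = g
      · subst hk; simp [hg]
      · simp [skewKetBra, hk, hj]
  have h2 : ∑ k, skewKetBra g a i k * H k j = -if i = g then star ((H *ᵥ a) j) else 0 := by
    split_ifs with hi
    · subst hi
      simp only [mulVec, dotProduct, star_sum, ← Finset.sum_neg_distrib]
      refine Finset.sum_congr rfl fun k _ => ?_
      by_cases hk : k = i
      · subst hk; simp [hg, hg']
      · rw [star_mul', hherm.apply]
        simp [skewKetBra, hk]; ring
    · rw [neg_zero]
      refine Finset.sum_eq_zero fun k _ => ?_
      by_cases hk : k = g
      · subst hk; simp [hg']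
      · simp [skewKetBra, hk, hi]
  rw [h1, h2]
  simp only [skewKetBra, of_apply, Pi.smul_apply, smul_eq_mul, star_mul']
  by_cases hi : i = g <;> by_cases hj : j = g <;> simp [hi, hj]

theorem lie_skewKetBra {a b : σ → ℂ} (ha : a g = 0) (hb : b g = 0) :
    ⁅skewKetBra g a, skewKetBra g b⁆ = vecMulVec b (star a) - vecMulVec a (star b) +
      (star b ⬝ᵥ a - star a ⬝ᵥ b) • single g g 1 := by
  have key : ∀ a b : σ → ℂ, a g = 0 → b g = 0 → skewKetBra g a * skewKetBra g b =
      -vecMulVec a (star b) - (star a ⬝ᵥ b) • single g g 1 := by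
    intro a b ha hb
    ext i j
    have e : ∀ k, skewKetBra g a i k * skewKetBra g b k j =
        -(if k = g then a i * star (b j) else 0) -
          (if i = g ∧ j = g then star (a k) * b k else 0) := by
      intro k
      simp only [skewKetBra, of_apply]
      by_cases hk : k = g
      · subst hk
        by_cases hi : i = k <;> by_cases hj : j = k <;> simp [hi, hj, ha, hb]
      · by_cases hi : i = g <;> by_cases hj : j = g <;> simp [hi, hj, hk]
    rw [mul_apply, Finset.sum_congr rfl fun k _ => e k]
    rw [Finset.sum_sub_distrib, Finset.sum_neg_distrib]
    simp only [Finset.sum_ite_eq', Finset.mem_univ, if_true, Matrix.sub_apply, Matrix.neg_apply, Matrix.smul_apply,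
      vecMulVec_apply, Pi.star_apply, single_apply, dotProduct]
    by_cases hi : i = g <;> by_cases hj : j = g <;> simp [hi, hj, eq_comm (a := g)]
  rw [Ring.lie_def, key a b ha hb, key b a hb ha, sub_smul]
  abel

theorem mem_of_skew_of_trace_eq_zero (h : ∀ a : σ → ℂ, a g = 0 → a ∈ couplings L g)
    {A : Matrix σ σ ℂ} (hA : Aᴴ = -A) (htr : A.trace = 0) : A ∈ L := by
  have hA' : ∀ i j, star (A i j) = -A j i := fun i j => by
    have := congrFun (congrFun hA j) i
    simpa using this
  set c : σ → ℂ := fun j => if j = g then 0 else A j g with hc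
  set B : Matrix σ σ ℂ := Matrix.of fun i j => if i = g ∨ j = g then 0 else A i j with hB
  set e : σ → σ → ℂ := fun k => if k = g then 0 else Pi.single k 1 with he
  set b : σ → σ → σ → ℂ := fun j k => B j k • e j with hb
  have heg : ∀ k, e k g = 0 := fun k => by
    simp only [he]; split_ifs with h1
    · rfl
    · exact Pi.single_eq_of_ne (fun h2 => h1 h2.symm) _
  have hbg : ∀ j k, b j k g = 0 := fun j k => by simp [hb, heg]
  have hBs : ∀ i j, star (B i j) = -B j i := fun i j => by
    simp only [hB, of_apply, or_comm (a := j = g)]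
    split_ifs <;> simp [← hA']
  have h1 : ∀ j k, ⁅skewKetBra g (e k), skewKetBra g (b j k)⁆ =
      single j k (B j k) + single k j (B k j) -
        (if j = k then 2 * B j j else 0) • single g g (1 : ℂ) := by
    intro j k
    rw [lie_skewKetBra (heg k) (hbg j k)]
    by_cases hjk : j = g ∨ k = g
    · have h2 : B j k = 0 := by simp [hB, hjk]
      have h3 : B k j = 0 := by simp [hB, hjk.symm]
      have h4 : j = k → B j j = 0 := by rintro rfl; exact h2
      have h5 : (if j = k then 2 * B j j else 0) = 0 := by
        split_ifs with h; · rw [h4 h, mul_zero]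
        · rfl
      simp [hb, h2, h3, h5]
    · have hj : j ≠ g := fun h => hjk (Or.inl h)
      have hk : k ≠ g := fun h => hjk (Or.inr h)
      have hej : e j = Pi.single j 1 := if_neg hj
      have hek : e k = Pi.single k 1 := if_neg hk
      have hstar : star (b j k) = -B k j • Pi.single j 1 := by
        simp only [hb, hej, star_smul, hBs, ← Pi.single_star, star_one]
      have hstar' : star (e k) = Pi.single k 1 := by
        rw [hek, ← Pi.single_star, star_one]
      have hv : ∀ (x z : σ) (r : ℂ), vecMulVec (r • Pi.single x 1) (Pi.single z 1) =
          single x z r := by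
        intro x z r
        ext p q
        simp only [vecMulVec_apply, Pi.smul_apply, Pi.single_apply, single_apply, smul_eq_mul]
        by_cases hp : p = x <;> by_cases hq : q = z <;> simp [hp, hq, eq_comm (a := x), eq_comm (a := z)]
      have hv' : ∀ (x z : σ) (r : ℂ), vecMulVec (Pi.single x 1) (r • Pi.single z 1) =
          single x z r := by
        intro x z r
        rw [← hv, vecMulVec_smul, smul_vecMulVec]
      rw [hstar, hstar', hek, hv']
      simp only [hb, hej, hv]
      have hd : (-B k j • Pi.single j 1 ⬝ᵥ (Pi.single k 1 : σ → ℂ) -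
          Pi.single k 1 ⬝ᵥ (B j k • Pi.single j 1 : σ → ℂ)) =
          -(if j = k then 2 * B j j else 0) := by
        by_cases h : j = k
        · subst h; simp; ring
        · simp [h, Ne.symm h]
      rw [hd, neg_smul]
      have hn : single k j (-B k j) = -single k j (B k j) := by
        ext p q; simp only [single_apply, Matrix.neg_apply]; split_ifs <;> simp
      rw [hn]; abel
  have hsum : ∑ j, ∑ k, ⁅skewKetBra g (e k), skewKetBra g (b j k)⁆ =
      B + B - (2 * ∑ j, B j j) • single g g (1 : ℂ) := by
    simp only [h1, Finset.sum_sub_distrib, Finset.sum_add_distrib]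
    congr 1
    · congr 1
      · exact (matrix_eq_sum_single B).symm
      · rw [Finset.sum_comm]; exact (matrix_eq_sum_single B).symm
    · simp only [← Finset.sum_smul, Finset.sum_ite_eq, Finset.mem_univ, if_true, Finset.mul_sum]
  have htrB : ∑ j, B j j = -A g g := by
    have : ∀ j, B j j = A j j - if j = g then A j j else 0 := fun j => by
      simp only [hB, of_apply, or_self]; split_ifs <;> simp
    simp only [this, Finset.sum_sub_distrib, Finset.sum_ite_eq', Finset.mem_univ, if_true]
    rw [show ∑ j, A j j = 0 from htr, zero_sub]
  -- Row and column g of A, off the diagonal, come from c. The double sum counts the remaining block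
  -- B twice, hence the factor 1/2; its entry at (g, g) is -tr B, which equals that of A because tr
  -- A = 0.
  have key : A = skewKetBra g c +
      (2⁻¹ : ℝ) • ∑ j, ∑ k, ⁅skewKetBra g (e k), skewKetBra g (b j k)⁆ := by
    rw [hsum, htrB]
    ext i j
    simp only [Matrix.add_apply, Matrix.smul_apply, Matrix.sub_apply, skewKetBra, of_apply,
      single_apply, hc, hB]
    by_cases hi : i = g <;> by_cases hj : j = g
    · subst hi; subst hj; simp
    · subst hi; simp [hj, hA', Ne.symm hj]
    · subst hj; simp [hi, Ne.symm hi]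
    · simp [hi, hj, Ne.symm hi]; ring
  rw [key]
  refine L.add_mem (h c (by simp [hc])) (L.smul_mem _ (L.toSubmodule.sum_mem fun j _ =>
    L.toSubmodule.sum_mem fun k _ => L.lie_mem (h _ (heg k)) (h _ (hbg j k))))

end Transitions

end DegenerateControl

/-! ### Matrix elements of the Hamiltonians and vectors on one level. -/

namespace DegenerateControl

open Matrix

section Levels

variable {N : ℕ}

theorem mem_states {a : ℕ × ℕ} :
    a ∈ states N ↔ (1 ≤ a.1 ∧ a.1 ≤ N) ∧ (1 ≤ a.2 ∧ a.2 ≤ 2) ∧ a.2 ≤ β a.1 := by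
  simp [states, and_assoc]

theorem mem_states_of_two_le {n k : ℕ} (hn : 2 ≤ n) (hN : n ≤ N) (hk : 1 ≤ k) (hk' : k ≤ 2) :
    (n, k) ∈ states N := by
  rw [mem_states, β, if_neg (by simp; omega)]
  exact ⟨⟨by simp; omega, hN⟩, ⟨hk, hk'⟩, hk'⟩

theorem H₀_eq_diagonal (E : ℕ → ℝ) :
    H₀ N E = diagonal (fun i : states N => (E (i : ℕ × ℕ).1 : ℂ)) := by
  ext ⟨⟨n, k⟩, hi⟩ ⟨b, hj⟩
  obtain ⟨⟨h1, h2⟩, ⟨h3, -⟩, h4⟩ := mem_states.1 hi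
  simp only [H₀, Matrix.sum_apply, Matrix.smul_apply, ket_bra, of_apply]
  rw [Finset.sum_eq_single n, Finset.sum_eq_single k]
  · by_cases hb : (n, k) = b
    · subst hb; simp
    · rw [diagonal_apply_ne _ (by simpa using hb)]
      simp [Ne.symm hb]
  · intro k' _ hk'
    simp [Ne.symm hk']
  · intro hk
    exact absurd (Finset.mem_Icc.2 ⟨h3, h4⟩) hk
  · intro n' _ hn'
    exact Finset.sum_eq_zero fun k' _ => by simp [Ne.symm hn']
  · intro hn
    exact absurd (Finset.mem_Icc.2 ⟨h1, h2⟩) hn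

/-- The real symmetric matrix elements of the dipole interaction. -/
def dipole (d : ℕ × ℕ → ℕ × ℕ → ℝ) (a b : ℕ × ℕ) : ℝ :=
  if b.1 = a.1 + 1 then d a b else if a.1 = b.1 + 1 then d b a else 0

theorem dipole_comm (d : ℕ × ℕ → ℕ × ℕ → ℝ) (a b : ℕ × ℕ) : dipole d a b = dipole d b a := by
  unfold dipole
  split_ifs <;> first | rfl | omega

theorem sum_ladder (d : ℕ × ℕ → ℕ × ℕ → ℝ) {a b : ℕ × ℕ} (ha : a ∈ states N)
    (hb : b ∈ states N) :
    ∑ n ∈ Finset.Icc 1 (N - 1), ∑ k ∈ Finset.Icc 1 (β n), ∑ p ∈ Finset.Icc 1 2,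
      (d (n, k) (n + 1, p) : ℂ) * (if a = (n, k) ∧ b = (n + 1, p) then 1 else 0) =
    if b.1 = a.1 + 1 then (d a b : ℂ) else 0 := by
  obtain ⟨n, k⟩ := a
  obtain ⟨m, l⟩ := b
  obtain ⟨⟨h1, h2⟩, ⟨h3, -⟩, h4⟩ := mem_states.1 ha
  obtain ⟨⟨-, h5⟩, ⟨h6, h7⟩, -⟩ := mem_states.1 hb
  simp only at h1 h2 h3 h4 h5 h6 h7
  split_ifs with h
  · simp only at h
    subst h
    rw [Finset.sum_eq_single n, Finset.sum_eq_single k, Finset.sum_eq_single l]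
    · simp
    · intro p _ hp; simp [Ne.symm hp]
    · intro hl; exact absurd (Finset.mem_Icc.2 ⟨h6, h7⟩) hl
    · intro k' _ hk'
      exact Finset.sum_eq_zero fun p _ => by simp [Ne.symm hk']
    · intro hk; exact absurd (Finset.mem_Icc.2 ⟨h3, h4⟩) hk
    · intro n' _ hn'
      exact Finset.sum_eq_zero fun k' _ => Finset.sum_eq_zero fun p _ => by simp [Ne.symm hn']
    · intro hn; exact absurd (Finset.mem_Icc.2 ⟨h1, by omega⟩) hn
  · refine Finset.sum_eq_zero fun n' _ => Finset.sum_eq_zero fun k' _ =>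
      Finset.sum_eq_zero fun p _ => ?_
    rw [if_neg, mul_zero]
    rintro ⟨e1, e2⟩
    simp only [Prod.mk.injEq] at e1 e2
    exact h (by simp only; omega)

theorem HI_apply (d : ℕ × ℕ → ℕ × ℕ → ℝ) (i j : states N) : HI N d i j = (dipole d i j : ℂ) := by
  have h : HI N d i j = (if (j : ℕ × ℕ).1 = (i : ℕ × ℕ).1 + 1 then (d i j : ℂ) else 0) +
      if (i : ℕ × ℕ).1 = (j : ℕ × ℕ).1 + 1 then (d j i : ℂ) else 0 := by
    rw [← sum_ladder d i.2 j.2, ← sum_ladder d j.2 i.2]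
    simp only [HI, Matrix.sum_apply, Matrix.smul_apply, Matrix.add_apply, ket_bra, of_apply,
      smul_eq_mul, mul_add, Finset.sum_add_distrib]
    simp only [and_comm]
  rw [h, dipole]
  split_ifs <;> first | omega | simp

/-- The vector with components `f` on level `m`. -/
def levelVec (N m : ℕ) (f : ℕ × ℕ → ℝ) : states N → ℂ :=
  fun j => if (j : ℕ × ℕ).1 = m then (f j : ℂ) else 0

theorem levelVec_congr {m : ℕ} (hm : 2 ≤ m) {f f' : ℕ × ℕ → ℝ} (h1 : f (m, 1) = f' (m, 1))
    (h2 : f (m, 2) = f' (m, 2)) : levelVec N m f = levelVec N m f' := by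
  ext ⟨⟨n, k⟩, hj⟩
  simp only [levelVec]
  split_ifs with h
  · subst h
    obtain ⟨-, ⟨h3, h4⟩, -⟩ := mem_states.1 hj
    simp only at h3 h4
    interval_cases k
    · rw [h1]
    · rw [h2]
  · rfl

theorem levelVec_linear (m : ℕ) (f f' : ℕ × ℕ → ℝ) (c c' : ℝ) :
    levelVec N m (fun a => c * f a + c' * f' a) = c • levelVec N m f + c' • levelVec N m f' := by
  ext j
  simp only [levelVec, Pi.add_apply, Pi.smul_apply]
  split_ifs <;> simp

theorem levelVec_eq_single {m : ℕ} (hm : 2 ≤ m) (hN : m ≤ N) (f : ℕ × ℕ → ℝ) :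
    levelVec N m f =
      (f (m, 1) : ℂ) • Pi.single ⟨(m, 1), mem_states_of_two_le hm hN le_rfl one_le_two⟩ 1 +
      (f (m, 2) : ℂ) • Pi.single ⟨(m, 2), mem_states_of_two_le hm hN one_le_two le_rfl⟩ 1 := by
  ext ⟨⟨n, k⟩, hj⟩
  obtain ⟨-, ⟨h3, h4⟩, -⟩ := mem_states.1 hj
  simp only at h3 h4
  simp only [levelVec, Pi.add_apply, Pi.smul_apply, Pi.single_apply, Subtype.mk.injEq,
    Prod.mk.injEq]
  by_cases h : n = m
  · subst h
    interval_cases k <;> simp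
  · simp [h]

/-- The interaction with the transitions from the ground level removed. -/
def excitedHI (N : ℕ) (d : ℕ × ℕ → ℕ × ℕ → ℝ) : Op N :=
  Matrix.of fun i j =>
    if (i : ℕ × ℕ).1 = 1 ∨ (j : ℕ × ℕ).1 = 1 then 0 else (dipole d i j : ℂ)

theorem excitedHI_isHermitian (d : ℕ × ℕ → ℕ × ℕ → ℝ) : (excitedHI N d).IsHermitian := by
  ext i j
  simp only [conjTranspose_apply, excitedHI, of_apply, or_comm (a := (j : ℕ × ℕ).1 = 1),
    dipole_comm d j i]
  split_ifs <;> simp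

theorem excitedHI_mulVec_levelVec {m m' : ℕ} (hm : 2 ≤ m) (hN : m ≤ N) (hm' : 2 ≤ m')
    (d : ℕ × ℕ → ℕ × ℕ → ℝ) (f : ℕ × ℕ → ℝ) (j : states N) :
    (if (j : ℕ × ℕ).1 = m' then (excitedHI N d *ᵥ levelVec N m f) j else 0) =
      levelVec N m' (fun a => f (m, 1) * dipole d a (m, 1) + f (m, 2) * dipole d a (m, 2)) j := by
  simp only [levelVec_eq_single hm hN, mulVec_add, mulVec_smul, mulVec_single_one, levelVec]
  split_ifs with h
  · simp only [Pi.add_apply, Pi.smul_apply, col_apply, excitedHI, of_apply, smul_eq_mul]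
    rw [if_neg (by omega), if_neg (by omega)]
    push_cast; ring
  · rfl

end Levels

/-! ### Couplings to the ground state, level by level. -/

section Generation

variable {N : ℕ} {E : ℕ → ℝ} {d : ℕ × ℕ → ℕ × ℕ → ℝ}

theorem energy_lt (hgap : ∀ n, 1 ≤ n → n ≤ N - 1 → 0 < μ E n) {n m : ℕ} (hn : 1 ≤ n)
    (hnm : n < m) (hm : m ≤ N) : E n < E m := by
  induction m, hnm using Nat.le_induction with
  | base => have := hgap n hn (by omega); unfold μ at this; simpa using this
  | succ m h ih =>
    have := hgap m (by omega) (by omega)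
    unfold μ at this
    have := ih (by omega)
    linarith

theorem energy_injective (hgap : ∀ n, 1 ≤ n → n ≤ N - 1 → 0 < μ E n) {n m : ℕ} (hn : 1 ≤ n)
    (hnN : n ≤ N) (hm : 1 ≤ m) (hmN : m ≤ N) : E n = E m ↔ n = m := by
  refine ⟨fun h => ?_, fun h => h ▸ rfl⟩
  rcases lt_trichotomy n m with h1 | h1 | h1
  · exact absurd h (energy_lt hgap hn h1 hmN).ne
  · exact h1
  · exact absurd h.symm (energy_lt hgap hm h1 hnN).ne

theorem one_one_mem_states (hN : 3 ≤ N) : ((1, 1) : ℕ × ℕ) ∈ states N := by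
  rw [mem_states, β, if_pos rfl]
  simp; omega

/-- The ground state. -/
def ground (hN : 3 ≤ N) : states N := ⟨(1, 1), one_one_mem_states hN⟩

theorem eq_ground_iff (hN : 3 ≤ N) {i : states N} : i = ground hN ↔ (i : ℕ × ℕ).1 = 1 := by
  refine ⟨fun h => h ▸ rfl, fun h => ?_⟩
  obtain ⟨⟨n, k⟩, hi⟩ := i
  simp only at h
  subst h
  obtain ⟨-, ⟨h3, -⟩, h4⟩ := mem_states.1 hi
  rw [β, if_pos rfl] at h4
  simp only at h3 h4
  exact Subtype.ext (Prod.ext rfl (le_antisymm h4 h3))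

theorem diagonal_mem_L₀ :
    Complex.I • diagonal (fun i : states N => ((E (i : ℕ × ℕ).1 : ℝ) : ℂ)) ∈ L₀ N E d := by
  rw [← H₀_eq_diagonal]
  exact LieSubalgebra.subset_lieSpan (by simp)

theorem HI_mem_L₀ : Complex.I • HI N d ∈ L₀ N E d := LieSubalgebra.subset_lieSpan (by simp)

/-- The ground-state transitions can be split off, since their frequency is unique. -/
theorem ground_levelVec_mem (hN : 3 ≤ N) (hgap : ∀ n, 1 ≤ n → n ≤ N - 1 → 0 < μ E n)
    (hμ : ∀ n, 2 ≤ n → n ≤ N - 1 → μ E 1 ≠ μ E n) :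
    Complex.I • levelVec N 2 (d (1, 1)) ∈ couplings (L₀ N E d) (ground hN) := by
  rw [mem_couplings]
  classical
  have key := spectral_filter_mem (diagonal_mem_L₀ (N := N) (E := E) (d := d))
    (HI_mem_L₀ (E := E)) (fun x => if x = (μ E 1) ^ 2 then 1 else 0)
  -- The filter sees only squared gaps, so positivity of the gaps is what keeps them apart.
  have hsq : ∀ n, 2 ≤ n → n ≤ N - 1 → (μ E n) ^ 2 ≠ (μ E 1) ^ 2 := by
    intro n h1 h2 h
    have h3 := hgap n (by omega) h2
    have h4 := hgap 1 le_rfl (by omega)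
    exact hμ n h1 h2 ((sq_eq_sq₀ h3.le h4.le).1 h).symm
  convert key using 1
  ext ⟨⟨n, k⟩, hi⟩ ⟨⟨m, l⟩, hj⟩
  obtain ⟨⟨h1, h2⟩, ⟨h3, -⟩, h4⟩ := mem_states.1 hi
  obtain ⟨⟨h1', h2'⟩, ⟨h3', -⟩, h4'⟩ := mem_states.1 hj
  simp only at h1 h2 h3 h4 h1' h2' h3' h4'
  simp only [skewKetBra, of_apply, Matrix.smul_apply, Pi.smul_apply, HI_apply, eq_ground_iff hN,
    levelVec, dipole, smul_eq_mul, star_mul', Complex.star_def, Complex.conj_I]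
  by_cases hm : m = n + 1
  · subst hm
    have e : E n - E (n + 1) = -μ E n := by unfold μ; ring
    rw [e, neg_sq]
    by_cases hn : n = 1
    · subst hn
      have hk : k = 1 := by rw [β, if_pos rfl] at h4; omega
      subst hk
      simp
    · have h5 := hsq n (by omega) (by omega)
      simp [h5, hn]
      omega
  · by_cases hn : n = m + 1
    · subst hn
      have e : E (m + 1) - E m = μ E m := rfl
      rw [e]
      by_cases hm1 : m = 1
      · subst hm1
        have hl : l = 1 := by rw [β, if_pos rfl] at h4'; omega
        subst hl
        simp
      · have h5 := hsq m (by omega) (by omega)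
        simp [h5, hm1]
        omega
    · by_cases hn1 : n = 1 <;> by_cases hm1 : m = 1
      · simp [hn1, hm1]
      · have : m ≠ 2 := by omega
        simp [hm, hn, hm1, this]
      · have : n ≠ 2 := by omega
        simp [hm, hn, hn1, this]
      · simp [hm, hn, hm1, hn1]

/-- What remains of H_I annihilates the ground state, as `mulVec_mem_couplings` requires. -/
theorem excitedHI_mem_L₀ (hN : 3 ≤ N)
    (h : Complex.I • levelVec N 2 (d (1, 1)) ∈ couplings (L₀ N E d) (ground hN)) :
    Complex.I • excitedHI N d ∈ L₀ N E d := by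
  rw [mem_couplings] at h
  convert (L₀ N E d).sub_mem (HI_mem_L₀ (E := E)) h using 1
  ext ⟨⟨n, k⟩, hi⟩ ⟨⟨m, l⟩, hj⟩
  obtain ⟨⟨h1, h2⟩, ⟨h3, -⟩, h4⟩ := mem_states.1 hi
  obtain ⟨⟨h1', h2'⟩, ⟨h3', -⟩, h4'⟩ := mem_states.1 hj
  simp only at h1 h2 h3 h4 h1' h2' h3' h4'
  simp only [skewKetBra, of_apply, Matrix.smul_apply, Matrix.sub_apply, Pi.smul_apply, HI_apply,
    eq_ground_iff hN, excitedHI, levelVec, dipole, smul_eq_mul, star_mul', Complex.star_def,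
    Complex.conj_I]
  by_cases hn1 : n = 1 <;> by_cases hm1 : m = 1
  · subst hn1; subst hm1; simp
  · subst hn1
    have hk : k = 1 := by rw [β, if_pos rfl] at h4; omega
    subst hk
    by_cases h2 : m = 2
    · subst h2; simp
    · simp [h2, hm1]; omega
  · subst hm1
    have hl : l = 1 := by rw [β, if_pos rfl] at h4'; omega
    subst hl
    by_cases h2 : n = 2
    · subst h2; simp
    · have h0 : n ≠ 0 := by omega
      simp [h2, hn1, h0]
  · simp [hn1, hm1]

/-- The differences Eₙ - E₁ are nonnegative and distinct, so their squares identify the level. -/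
theorem level_filter_mem (hN : 3 ≤ N) (hgap : ∀ n, 1 ≤ n → n ≤ N - 1 → 0 < μ E n) {m : ℕ}
    (hm : 2 ≤ m) (hmN : m ≤ N) {a : states N → ℂ} (ha : a ∈ couplings (L₀ N E d) (ground hN)) :
    (fun j : states N => if (j : ℕ × ℕ).1 = m then a j else 0) ∈
      couplings (L₀ N E d) (ground hN) := by
  classical
  convert filter_mem_couplings diagonal_mem_L₀ ha
    (fun x => if x = (E m - E 1) ^ 2 then 1 else 0) using 1
  ext ⟨⟨n, k⟩, hi⟩
  obtain ⟨⟨h1, h2⟩, -⟩ := mem_states.1 hi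
  have h3 : (E n - E 1) ^ 2 = (E m - E 1) ^ 2 ↔ n = m := by
    have h4 : E 1 ≤ E n := by
      rcases h1.eq_or_lt with h | h
      · exact h ▸ le_rfl
      · exact (energy_lt hgap le_rfl h h2).le
    have h5 := energy_lt hgap le_rfl (show 1 < m by omega) hmN
    rw [sq_eq_sq₀ (by linarith) (by linarith), sub_left_inj,
      energy_injective hgap h1 h2 (by omega) hmN]
  simp only [ground, h3]
  split_ifs <;> simp

/-- On level m the bracket with iH₀ is multiplication by i(E_m - E₁), and the real factor is
nonzero. Thus couplings on a single level form a complex space. -/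
theorem I_smul_mem_of_level (hN : 3 ≤ N) (hgap : ∀ n, 1 ≤ n → n ≤ N - 1 → 0 < μ E n) {m : ℕ}
    (hm : 2 ≤ m) (hmN : m ≤ N) {a : states N → ℂ}
    (hsupp : ∀ j : states N, (j : ℕ × ℕ).1 ≠ m → a j = 0) (ha : a ∈
      couplings (L₀ N E d) (ground hN)) :
    Complex.I • a ∈ couplings (L₀ N E d) (ground hN) := by
  have h5 := energy_lt hgap le_rfl (show 1 < m by omega) hmN
  have h6 : (E m : ℂ) - E 1 ≠ 0 := by
    rw [← Complex.ofReal_sub]; exact_mod_cast (sub_pos.2 h5).ne'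
  convert (couplings (L₀ N E d) (ground hN)).smul_mem (E m - E 1)⁻¹
    (lie_diagonal_mem_couplings diagonal_mem_L₀ ha) using 1
  ext j
  by_cases hj : (j : ℕ × ℕ).1 = m
  · simp only [Pi.smul_apply, smul_eq_mul, hj, ground, Complex.real_smul]
    push_cast
    field_simp
  · simp [hsupp j hj]

theorem levelVec_of_ne {m : ℕ} {f : ℕ × ℕ → ℝ} {j : states N} (hj : (j : ℕ × ℕ).1 ≠ m) :
    levelVec N m f j = 0 := if_neg hj

theorem I_smul_levelVec_mem_iff (hN : 3 ≤ N) (hgap : ∀ n, 1 ≤ n → n ≤ N - 1 → 0 < μ E n)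
    {m : ℕ} (hm : 2 ≤ m) (hmN : m ≤ N) {f : ℕ × ℕ → ℝ} :
    Complex.I • levelVec N m f ∈ couplings (L₀ N E d) (ground hN) ↔
      levelVec N m f ∈ couplings (L₀ N E d) (ground hN) := by
  constructor
  · intro h
    have := I_smul_mem_of_level hN hgap hm hmN
      (fun j hj => by simp [levelVec_of_ne hj]) h
    rw [smul_smul, Complex.I_mul_I, neg_one_smul] at this
    simpa using Submodule.neg_mem _ this
  · exact I_smul_mem_of_level hN hgap hm hmN fun j hj => levelVec_of_ne hj

/-- Applying the interaction to a level vector and projecting to another excited level. -/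
theorem levelVec_transfer (hN : 3 ≤ N) (hgap : ∀ n, 1 ≤ n → n ≤ N - 1 → 0 < μ E n)
    (hH : Complex.I • excitedHI N d ∈ L₀ N E d) {m m' : ℕ} (hm : 2 ≤ m) (hmN : m ≤ N)
    (hm' : 2 ≤ m') (hmN' : m' ≤ N) {f : ℕ × ℕ → ℝ}
    (h : levelVec N m f ∈ couplings (L₀ N E d) (ground hN)) :
    levelVec N m' (fun a => f (m, 1) * dipole d a (m, 1) + f (m, 2) * dipole d a (m, 2)) ∈
      couplings (L₀ N E d) (ground hN) := by
  have h1 := mulVec_mem_couplings hH (excitedHI_isHermitian d)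
    (fun i => by simp [excitedHI, ground]) h
  have h2 := level_filter_mem hN hgap hm' hmN' h1
  rw [← I_smul_levelVec_mem_iff hN hgap hm' hmN']
  convert h2 using 1
  ext j
  rw [Pi.smul_apply, ← excitedHI_mulVec_levelVec hm hmN hm']
  split_ifs <;> simp

theorem all_levelVec_mem (hN : 3 ≤ N) {m : ℕ} (hm : 2 ≤ m) {v u : ℕ × ℕ → ℝ}
    (hv : levelVec N m v ∈ couplings (L₀ N E d) (ground hN))
    (hu : levelVec N m u ∈ couplings (L₀ N E d) (ground hN))
    (hdet : v (m, 1) * u (m, 2) ≠ v (m, 2) * u (m, 1)) (f : ℕ × ℕ → ℝ) :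
    levelVec N m f ∈ couplings (L₀ N E d) (ground hN) := by
  have hD : v (m, 1) * u (m, 2) - v (m, 2) * u (m, 1) ≠ 0 := sub_ne_zero.2 hdet
  set D := v (m, 1) * u (m, 2) - v (m, 2) * u (m, 1) with hDdef
  -- The coefficients are those of Cramer's rule for f in terms of v and u.
  have h := Submodule.add_mem _
    (Submodule.smul_mem _ ((f (m, 1) * u (m, 2) - f (m, 2) * u (m, 1)) / D) hv)
    (Submodule.smul_mem _ ((v (m, 1) * f (m, 2) - v (m, 2) * f (m, 1)) / D) hu)
  rw [← levelVec_linear] at h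
  rwa [levelVec_congr hm (f' := f)] at h
  · field_simp; rw [hDdef]; ring
  · field_simp; rw [hDdef]; ring

theorem mem_couplings_of_levels (hN : 3 ≤ N) (hgap : ∀ n, 1 ≤ n → n ≤ N - 1 → 0 < μ E n)
    (h : ∀ m, 2 ≤ m → m ≤ N → ∀ f, levelVec N m f ∈ couplings (L₀ N E d) (ground hN))
    {a : states N → ℂ} (ha : a (ground hN) = 0) : a ∈ couplings (L₀ N E d) (ground hN) := by
  classical
  let ext (φ : ℂ → ℝ) : ℕ × ℕ → ℝ := fun b => if hb : b ∈ states N then φ (a ⟨b, hb⟩) else 0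
  have key : a = ∑ m ∈ Finset.Icc 2 N,
      (levelVec N m (ext Complex.re) + Complex.I • levelVec N m (ext Complex.im)) := by
    funext j
    rw [Finset.sum_apply]
    have e : ∀ m, (levelVec N m (ext Complex.re) + Complex.I • levelVec N m (ext Complex.im)) j =
        if (j : ℕ × ℕ).1 = m then a j else 0 := by
      intro m
      simp only [Pi.add_apply, Pi.smul_apply, levelVec, ext, j.2, dif_pos, smul_eq_mul]
      split_ifs
      · rw [mul_comm, Complex.re_add_im]
      · simp
    simp only [e, Finset.sum_ite_eq, Finset.mem_Icc]
    obtain ⟨⟨h1, h2⟩, -⟩ := mem_states.1 j.2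
    by_cases hj : (j : ℕ × ℕ).1 = 1
    · rw [← eq_ground_iff hN] at hj
      rw [hj, ha]; simp
    · rw [if_pos ⟨by omega, h2⟩]
  rw [key]
  refine Submodule.sum_mem _ fun m hm => ?_
  obtain ⟨h1, h2⟩ := Finset.mem_Icc.1 hm
  exact Submodule.add_mem _ (h m h1 h2 _)
    ((I_smul_levelVec_mem_iff hN hgap h1 h2).2 (h m h1 h2 _))

end Generation

end DegenerateControl

/-! ### All levels, su, and controllability. -/

namespace DegenerateControl

open Matrix

section Main

variable {N : ℕ} {E : ℕ → ℝ} {d : ℕ × ℕ → ℕ × ℕ → ℝ}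

theorem second_level_mem (hN : 3 ≤ N) (hgap : ∀ n, 1 ≤ n → n ≤ N - 1 → 0 < μ E n)
    (hμ : ∀ n, 2 ≤ n → n ≤ N - 1 → μ E 1 ≠ μ E n) {p q : ℝ}
    (hp : p = d (1, 1) (2, 1) * d (2, 1) (3, 1) + d (1, 1) (2, 2) * d (2, 2) (3, 1))
    (hq : q = d (1, 1) (2, 1) * d (2, 1) (3, 2) + d (1, 1) (2, 2) * d (2, 2) (3, 2))
    (hpq : d (1, 1) (2, 1) * (p * d (2, 2) (3, 1) + q * d (2, 2) (3, 2)) ≠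
      d (1, 1) (2, 2) * (p * d (2, 1) (3, 1) + q * d (2, 1) (3, 2))) (f : ℕ × ℕ → ℝ) :
    levelVec N 2 f ∈ couplings (L₀ N E d) (ground hN) := by
  have hIv := ground_levelVec_mem (d := d) hN hgap hμ
  have hH := excitedHI_mem_L₀ hN hIv
  have hv := (I_smul_levelVec_mem_iff hN hgap le_rfl (by omega)).1 hIv
  -- On level 3 this vector has components (p, q); sent back to level 2 it becomes `hu`, and `hpq`
  -- is its independence of the initial vector.
  have hw := levelVec_transfer hN hgap hH le_rfl (by omega) (show 2 ≤ 3 by omega) hN hv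
  have hu := levelVec_transfer hN hgap hH (by omega) hN le_rfl (by omega) hw
  refine all_levelVec_mem hN le_rfl hv hu ?_ f
  simpa [dipole, ← hp, ← hq] using hpq

/-- The two basis vectors of level m are sent to level m + 1 as the rows of the dipole matrix
between these levels, whose determinant is nonzero. -/
theorem every_level_mem (hN : 3 ≤ N) (hgap : ∀ n, 1 ≤ n → n ≤ N - 1 → 0 < μ E n)
    (hH : Complex.I • excitedHI N d ∈ L₀ N E d)
    (h2 : ∀ f, levelVec N 2 f ∈ couplings (L₀ N E d) (ground hN))
    (hdet : ∀ n, 2 ≤ n → n ≤ N - 1 →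
      d (n, 1) (n + 1, 1) * d (n, 2) (n + 1, 2) ≠ d (n, 1) (n + 1, 2) * d (n, 2) (n + 1, 1))
    {m : ℕ} (hm : 2 ≤ m) (hmN : m ≤ N) (f : ℕ × ℕ → ℝ) :
    levelVec N m f ∈ couplings (L₀ N E d) (ground hN) := by
  induction m, hm using Nat.le_induction generalizing f with
  | base => exact h2 f
  | succ m hm ih =>
    have h1 := levelVec_transfer hN hgap hH hm (by omega) (show 2 ≤ m + 1 by omega) hmN
      (ih (by omega) fun a => if a = (m, 1) then 1 else 0)
    have h1' := levelVec_transfer hN hgap hH hm (by omega) (show 2 ≤ m + 1 by omega) hmN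
      (ih (by omega) fun a => if a = (m, 2) then 1 else 0)
    refine all_levelVec_mem hN (by omega) h1 h1' ?_ f
    have h3 : m ≠ m + 1 + 1 := by omega
    simpa [dipole, h3] using hdet m hm (by omega)

theorem y_mem_L₀ (hN : 3 ≤ N)
    (h2 : ∀ f, levelVec N 2 f ∈ couplings (L₀ N E d) (ground hN)) (k : ℕ) :
    y N (1, 1) (2, k) ∈ L₀ N E d := by
  have h := (L₀ N E d).neg_mem (mem_couplings.1 (h2 fun a => if a = (2, k) then 1 else 0))
  suffices e : y N (1, 1) (2, k) =
      -skewKetBra (ground hN) (levelVec N 2 fun a => if a = (2, k) then 1 else 0) by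
    rw [e]; exact h
  ext i j
  have e : ∀ i : states N, (i : ℕ × ℕ) = (1, 1) ↔ i = ground hN := fun i => by
    rw [Subtype.ext_iff]; rfl
  have e' : ∀ i : states N, levelVec N 2 (fun a => if a = (2, k) then 1 else 0) i =
      if (i : ℕ × ℕ) = (2, k) then 1 else 0 := fun i => by
    simp only [levelVec]
    by_cases hi : (i : ℕ × ℕ) = (2, k)
    · simp [hi]
    · simp [hi]
  simp only [y, ket_bra, skewKetBra, Matrix.sub_apply, Matrix.neg_apply, of_apply, e, e']
  by_cases hi : i = ground hN <;> by_cases hj : j = ground hN <;> simp [hi, hj]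

theorem HI_isHermitian : (HI N d)ᴴ = HI N d := by
  ext i j
  rw [conjTranspose_apply, HI_apply, HI_apply, dipole_comm]
  simp

theorem HI_trace : (HI N d).trace = 0 :=
  Finset.sum_eq_zero fun i _ => by simp [diag_apply, HI_apply, dipole]

theorem H₀_isHermitian : (H₀ N E)ᴴ = H₀ N E := by
  rw [H₀_eq_diagonal, diagonal_conjTranspose]
  congr 1
  ext i; simp

theorem L₀_le_su (htr : (H₀ N E).trace = 0) : L₀ N E d ≤ su N := by
  refine LieSubalgebra.lieSpan_le.2 ?_
  rintro _ (rfl | rfl)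
  · exact ⟨by rw [conjTranspose_smul, H₀_isHermitian]; simp, by rw [trace_smul, htr, smul_zero]⟩
  · exact ⟨by rw [conjTranspose_smul, HI_isHermitian]; simp,
      by rw [trace_smul, HI_trace, smul_zero]⟩

/-- The fields c = 0 and c = 1 suffice: iH₀ is minus the generator at 0, and iH_I is the generator
at 0 minus that at 1. -/
theorem L₀_le_lieSpan_hamiltonians : L₀ N E d ≤ LieSubalgebra.lieSpan ℝ (Op N)
    (Set.range fun c : ℝ => -Complex.I • (H₀ N E + (c : ℂ) • HI N d)) := by
  have h : ∀ c : ℝ, -Complex.I • (H₀ N E + (c : ℂ) • HI N d) ∈ LieSubalgebra.lieSpan ℝ (Op N)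
      (Set.range fun c : ℝ => -Complex.I • (H₀ N E + (c : ℂ) • HI N d)) :=
    fun c => LieSubalgebra.subset_lieSpan ⟨c, rfl⟩
  refine LieSubalgebra.lieSpan_le.2 ?_
  rintro _ (rfl | rfl)
  · convert neg_mem (h 0) using 1
    simp
  · convert sub_mem (h 0) (h 1) using 1
    simp [smul_add]

theorem completelyControllable_of_su_le (hN : 3 ≤ N) (hsu : su N ≤ L₀ N E d) :
    CompletelyControllable N E d := by
  have : Nonempty (states N) := ⟨ground hN⟩
  have hgen : ∀ t c : ℝ, NormedSpace.exp ((-Complex.I * (t : ℂ)) • (H₀ N E + (c : ℂ) • HI N d)) =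
      NormedSpace.exp (Complex.I • ((-t : ℂ) • (H₀ N E + (c : ℂ) • HI N d))) := by
    intro t c
    rw [smul_smul]; congr 2; ring
  have hherm : ∀ t c : ℝ, ((-t : ℂ) • (H₀ N E + (c : ℂ) • HI N d)).IsHermitian := by
    intro t c
    rw [IsHermitian, conjTranspose_smul, conjTranspose_add, conjTranspose_smul, H₀_isHermitian,
      HI_isHermitian]
    simp
  refine specialUnitaryGroup_le_of_lieSpan
    (𝒜 := Set.range fun c : ℝ => -Complex.I • (H₀ N E + (c : ℂ) • HI N d)) ?_ ?_ ?_
  · rintro _ ⟨c, rfl⟩ t ht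
    refine Submonoid.subset_closure ⟨t, ht, c, ?_⟩
    congr 1
    ext i j
    simp; ring
  · exact fun A hA htr => L₀_le_lieSpan_hamiltonians (hsu ⟨hA, htr⟩)
  -- With tr H₀ = 0 all evolutions are special unitary; otherwise they are merely unitary, but iH₀
  -- supplies the missing direction with nonzero trace.
  · by_cases htr : (H₀ N E).trace = 0
    · left
      refine Submonoid.closure_le.2 ?_
      rintro _ ⟨t, -, c, rfl⟩
      rw [hgen]
      refine mem_specialUnitaryGroup_iff.2 ⟨exp_I_smul_mem_unitaryGroup (hherm t c), ?_⟩
      rw [det_exp_I_smul (hherm t c), trace_smul, trace_add, trace_smul, htr, HI_trace]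
      simp
    · right
      refine ⟨?_, Complex.I • H₀ N E, L₀_le_lieSpan_hamiltonians
        (LieSubalgebra.subset_lieSpan (by simp)), ?_, ?_⟩
      · refine Submonoid.closure_le.2 ?_
        rintro _ ⟨t, -, c, rfl⟩
        rw [hgen]
        exact exp_I_smul_mem_unitaryGroup (hherm t c)
      · rw [conjTranspose_smul, H₀_isHermitian]; simp
      · rw [trace_smul]; simp [htr]

end Main

end DegenerateControl

theorem theorem1 (N : ℕ) (hN : 3 ≤ N) (E : ℕ → ℝ) (d : ℕ × ℕ → ℕ × ℕ → ℝ)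
    (hgap : ∀ n, 1 ≤ n → n ≤ N - 1 → 0 < DegenerateControl.μ E n)
    (hμ : ∀ n, 2 ≤ n → n ≤ N - 1 → DegenerateControl.μ E 1 ≠ DegenerateControl.μ E n)
    (p q : ℝ)
    (hp : p = d (1, 1) (2, 1) * d (2, 1) (3, 1) + d (1, 1) (2, 2) * d (2, 2) (3, 1))
    (hq : q = d (1, 1) (2, 1) * d (2, 1) (3, 2) + d (1, 1) (2, 2) * d (2, 2) (3, 2))
    (hpq : d (1, 1) (2, 1) * (p * d (2, 2) (3, 1) + q * d (2, 2) (3, 2)) ≠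
      d (1, 1) (2, 2) * (p * d (2, 1) (3, 1) + q * d (2, 1) (3, 2))) :
    (DegenerateControl.y N (1, 1) (2, 1) ∈ DegenerateControl.L₀ N E d ∧
      DegenerateControl.y N (1, 1) (2, 2) ∈ DegenerateControl.L₀ N E d) ∧
    ((∀ n, 2 ≤ n → n ≤ N - 1 →
        d (n, 1) (n + 1, 1) * d (n, 2) (n + 1, 2) ≠ d (n, 1) (n + 1, 2) * d (n, 2) (n + 1, 1)) →
      DegenerateControl.su N ≤ DegenerateControl.L₀ N E d ∧
      ((DegenerateControl.H₀ N E).trace = 0 →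
        DegenerateControl.L₀ N E d = DegenerateControl.su N) ∧
      DegenerateControl.CompletelyControllable N E d) := by
  have h2 := DegenerateControl.second_level_mem hN hgap hμ hp hq hpq
  refine ⟨⟨DegenerateControl.y_mem_L₀ hN h2 1, DegenerateControl.y_mem_L₀ hN h2 2⟩, fun hdet => ?_⟩
  have hH := DegenerateControl.excitedHI_mem_L₀ hN
    (DegenerateControl.ground_levelVec_mem (d := d) hN hgap hμ)
  have hsu : DegenerateControl.su N ≤ DegenerateControl.L₀ N E d := fun A hA =>
    DegenerateControl.mem_of_skew_of_trace_eq_zero (g := DegenerateControl.ground hN)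
      (fun a ha => DegenerateControl.mem_couplings_of_levels hN hgap
        (fun m hm hmN => DegenerateControl.every_level_mem hN hgap hH h2 hdet hm hmN) ha)
      hA.1 hA.2
  exact ⟨hsu, fun htr => le_antisymm (DegenerateControl.L₀_le_su htr) hsu,
    DegenerateControl.completelyControllable_of_su_le hN hsu⟩
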